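/- Notation. Fix integers $n\ge 1$ and $d\ge 0$. For $\theta\in\mathbb R^d$ let $\theta^2=(\theta_j^2)_{j}$. A set $S\subset\mathbb R^d$ is quadratically convex if $\{\theta^2:\theta\in S\}$ is convex, and orthosymmetric if $(s_j\theta_j)_j\in S$ for all $\theta\in S$ and $s\in\{\pm1\}^d$. A norm $\gamma$ on $\mathbb R^d$ is quadratically convex if its unit ball is, and orthosymmetric if $\gamma((s_jv_j)_j)=\gamma(v)$ for all $v\in\mathbb R^d$, $s\in\{\pm1\}^d$. Its dual norm is $\gamma^*(z)=\sup_{\gamma(x)\le1}x^\top z$. For a measurable space $\mathcal X$ let $\mathcal F_{\mathcal X}$ be the set of all $F:\mathbb R^d\times\mathcal X\to\mathbb R$ such that $F(\theta,\cdot)$ is measurable for every $\theta$, $F(\cdot,x)$ is convex for every $x$, and $\gamma(g)\le1$ for all $x\in\mathcal X$, $\theta\in\mathbb R^d$ and all subgradients $g\in\partial_\theta F(\theta,x)$. A procedure observes each sample point $x_i$ together with the loss function $F(\cdot,x_i)$; write $o_i=(x_i,F(\cdot,x_i))$ (functions $\mathbb R^d\to\mathbb R$ carry the $\sigma$-algebra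 generated by evaluations). For a set $\Theta\subset\mathbb R^d$ define the minimax stochastic risk $$\mathfrak M^{\mathsf S}_n(\Theta,\gamma)=\sup_{\mathcal X}\ \sup_{\mathcal P}\ \inf_{\widehat\theta}\ \sup_{F\in\mathcal F_{\mathcal X}}\ \sup_{P\in\mathcal P}\ \mathbf E\Big[f_P\big(\widehat\theta(o_1,\dots,o_n)\big)-\inf_{\theta\in\Theta}f_P(\theta)\Big],\qquad f_P(\theta)=\int F(\theta,x)\,dP(x),$$ where $\mathcal P$ ranges over the sets of probability measures on $\mathcal X$, $\widehat\theta$ over the measurable $\mathbb R^d$-valued maps, only pairs $(F,P)$ with $F(\theta,\cdot)$ $P$-integrable for all $\theta$ are considered, $x_1,\dots,x_n$ are i.i.d. from $P$, and the expectation is an extended real number, $+\infty$ if the positive part has infinite mean. Define the (average) minimax regret $$\mathfrak M^{\mathsf R}_n(\Theta,\gamma)=\sup_{\mathcal X}\ \inf_{\widehat\theta_1,\dots,\widehat\theta_n}\ \sup_{F\in\mathcal F_{\mathcal X}}\ \sup_{x_1,\dots,x_n\in\mathcal X}\ \sup_{\theta\in\Theta}\ \frac1n\sum_{i=1}^n\Big[F\big(\widehat\theta_i(o_1,\dots,o_{i-1}),x_i\big)-F(\theta,x_i)\Big],$$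 with $\widehat\theta_i$ measurable. The decisions are not constrained to lie in $\Theta$. Theorem. Let $\Theta\subset\mathbb R^d$ be non-empty, compact, orthosymmetric and quadratically convex, and let $\gamma$ be an orthosymmetric and quadratically convex norm on $\mathbb R^d$. Then $$\frac1{8\sqrt{\log3}}\,\frac1{\sqrt n}\,\sup_{\theta\in\Theta}\gamma^*(\theta)\ \le\ \mathfrak M^{\mathsf S}_n(\Theta,\gamma)\ \le\ \mathfrak M^{\mathsf R}_n(\Theta,\gamma)\ \le\ \frac1{\sqrt n}\,\sup_{\theta\in\Theta}\gamma^*(\theta).$$ Moreover some diagonally scaled gradient method attains the upper bound: there is $\lambda^*\in\mathbb R^d$ with $\lambda^*_j\ge0$ for all $j$, and $\lambda^*_j>0$ for every coordinate $j$ that does not vanish identically on $\Theta$, such that for all convex $f_1,\dots,f_n:\mathbb R^d\to\mathbb R$ all of whose subgradients $g$ satisfy $\gamma(g)\le1$, and every choice of subgradients $g_i\in\partial f_i(\theta_i)$, the iterates $\theta_1=0$, $\theta_{i+1,j}=\theta_{i,j}-g_{i,j}/\lambda^*_j$ (where coordinates with $\lambda^*_j=0$ are left unchanged) satisfy $$\sup_{\theta\in\Theta}\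 \frac1n\sum_{i=1}^n\big[f_i(\theta_i)-f_i(\theta)\big]\ \le\ \frac1{\sqrt n}\sup_{\theta\in\Theta}\gamma^*(\theta).$$ -/

import Mathlib

open MeasureTheory

universe u

noncomputable section

namespace MinimaxGeometry

/-- Vectors of `ℝ^d`. Only coordinates, the topology and the Borel sets are used, never the
sup norm of this type. -/
abbrev Vec (d : ℕ) : Type := Fin d → ℝ

/-- `θ² = (θ_j²)_j`. -/
def coordSq {d : ℕ} (θ : Vec d) : Vec d := fun j => θ j ^ 2

/-- `S` is quadratically convex: `S² = {θ² | θ ∈ S}` is convex. -/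
def QuadConvex {d : ℕ} (S : Set (Vec d)) : Prop := Convex ℝ (coordSq '' S)

/-- `s ∈ {±1}^d`. -/
def IsSignVec {d : ℕ} (s : Vec d) : Prop := ∀ j, s j = 1 ∨ s j = -1

/-- `S` is invariant under flipping the signs of any coordinates. -/
def Orthosymmetric {d : ℕ} (S : Set (Vec d)) : Prop :=
  ∀ θ ∈ S, ∀ s : Vec d, IsSignVec s → (fun j => s j * θ j) ∈ S

/-- The seminorm `γ` is a norm. -/
def IsNorm {d : ℕ} (γ : Seminorm ℝ (Vec d)) : Prop := ∀ v, γ v = 0 → v = 0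

/-- `γ (s ⊙ v) = γ v` for all sign vectors `s`. -/
def OrthosymmetricNorm {d : ℕ} (γ : Seminorm ℝ (Vec d)) : Prop :=
  ∀ s v : Vec d, IsSignVec s → γ (fun j => s j * v j) = γ v

/-- The unit ball of `γ` is quadratically convex. -/
def QuadConvexNorm {d : ℕ} (γ : Seminorm ℝ (Vec d)) : Prop :=
  QuadConvex {v : Vec d | γ v ≤ 1}

/-- The dual norm `γ*(z) = sup {xᵀz | γ(x) ≤ 1}` (the supremum is finite if `γ` is a norm). -/
def dualNorm {d : ℕ} (γ : Seminorm ℝ (Vec d)) (z : Vec d) : ℝ :=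
  sSup ((fun x : Vec d => x ⬝ᵥ z) '' {x | γ x ≤ 1})

/-- The subdifferential `∂f(θ)`. -/
def subdifferential {d : ℕ} (f : Vec d → ℝ) (θ : Vec d) : Set (Vec d) :=
  {g | ∀ τ, f θ + g ⬝ᵥ (τ - θ) ≤ f τ}

/-- Convex functions on `ℝ^d` all of whose subgradients `g` satisfy `γ g ≤ r`. -/
def ConvexLosses {d : ℕ} (γ : Seminorm ℝ (Vec d)) (r : ℝ) : Set (Vec d → ℝ) :=
  {f | ConvexOn ℝ Set.univ f ∧ ∀ θ, ∀ g ∈ subdifferential f θ, γ g ≤ r}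

/-- The family `F^{γ,r}` of losses `F : ℝ^d × X → ℝ`: convex in `θ` with subgradients in the
`γ`-ball of radius `r`, and measurable in `x`. -/
def lossFamily {d : ℕ} (X : Type u) [MeasurableSpace X] (γ : Seminorm ℝ (Vec d)) (r : ℝ) :
    Set (Vec d → X → ℝ) :=
  {F | (∀ x, (fun θ => F θ x) ∈ ConvexLosses γ r) ∧ ∀ θ, Measurable (F θ)}

/-- What a procedure is shown of one sample point: the point `x` and its loss `F(·, x)`. The space
of functions `ℝ^d → ℝ` carries the σ-algebra generated by the evaluations. -/
abbrev Obs (d : ℕ) (X : Type u) : Type u := X × (Vec d → ℝ)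

/-- The observation made at the sample point `x` when the loss is `F`. -/
def observe {d : ℕ} {X : Type u} (F : Vec d → X → ℝ) (x : X) : Obs d X :=
  (x, fun θ => F θ x)

/-- The expectation of a real random variable as an extended real number,
`E[Y⁺] - E[Y⁻]`, with the value `+∞` as soon as `E[Y⁺] = ∞`. -/
def expectation {Ω : Type*} [MeasurableSpace Ω] (μ : Measure Ω) (Y : Ω → ℝ) : EReal :=
  open Classical in
  if (∫⁻ ω, ENNReal.ofReal (Y ω) ∂μ) = ⊤ then ⊤
  else ((∫⁻ ω, ENNReal.ofReal (Y ω) ∂μ : ENNReal) : EReal)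
    - ((∫⁻ ω, ENNReal.ofReal (-Y ω) ∂μ : ENNReal) : EReal)

/-- The expected loss `f_P(θ) = ∫ F(θ, x) dP(x)`. -/
def expLoss {d : ℕ} {X : Type u} [MeasurableSpace X] (F : Vec d → X → ℝ)
    (P : ProbabilityMeasure X) (θ : Vec d) : ℝ :=
  ∫ x, F θ x ∂(P : Measure X)

/-- The minimax stochastic risk for the losses `𝓕` and the distributions `𝓟`: the infimum over
measurable estimators of the supremum over `F ∈ 𝓕`, `P ∈ 𝓟` (with `f_P` well defined) of
`E[f_P(est(X_1, …, X_n)) - inf_Θ f_P]`, where `X_1, …, X_n` are iid from `P`. -/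
def stochasticRisk {d : ℕ} {X : Type u} [MeasurableSpace X] (n : ℕ) (Θ : Set (Vec d))
    (𝓕 : Set (Vec d → X → ℝ)) (𝓟 : Set (ProbabilityMeasure X)) : EReal :=
  ⨅ est : {e : (Fin n → Obs d X) → Vec d // Measurable e},
    ⨆ F ∈ 𝓕, ⨆ P ∈ 𝓟, ⨆ (_ : ∀ θ, Integrable (F θ) (P : Measure X)),
      expectation (Measure.pi fun _ : Fin n => (P : Measure X))
        (fun x => expLoss F P (est.1 fun i => observe F (x i)) - sInf (expLoss F P '' Θ))

/-- The (average) minimax regret for the losses `𝓕`: the infimum over sequences of measurable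
decisions, the `i`-th one based on the observations before `i`, of the supremum over `F ∈ 𝓕`,
`x_1, …, x_n ∈ X` and `θ ∈ Θ` of `(1/n) ∑ i, (F(θ_i, x_i) - F(θ, x_i))`. -/
def regret {d : ℕ} {X : Type u} [MeasurableSpace X] (n : ℕ) (Θ : Set (Vec d))
    (𝓕 : Set (Vec d → X → ℝ)) : EReal :=
  ⨅ alg : {a : (i : Fin n) → (Fin i.1 → Obs d X) → Vec d // ∀ i, Measurable (a i)},
    ⨆ F ∈ 𝓕, ⨆ x : Fin n → X, ⨆ θ ∈ Θ,
      (((1 / (n : ℝ)) * ∑ i : Fin n,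
        (F (alg.1 i fun k => observe F (x (Fin.castLE i.2.le k))) (x i) - F θ (x i)) : ℝ) : EReal)

/-- `M^S(Θ, γ)`: the supremum of the minimax stochastic risk of `F^{γ,1}` over all sample spaces
and all sets of distributions. -/
def minimaxStochasticRisk {d : ℕ} (n : ℕ) (Θ : Set (Vec d)) (γ : Seminorm ℝ (Vec d)) : EReal :=
  ⨆ (X : Type u) (_ : MeasurableSpace X) (𝓟 : Set (ProbabilityMeasure X)),
    stochasticRisk n Θ (lossFamily X γ 1) 𝓟

/-- `M^R(Θ, γ)`: the supremum of the minimax regret of `F^{γ,1}` over all sample spaces. -/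
def minimaxRegret {d : ℕ} (n : ℕ) (Θ : Set (Vec d)) (γ : Seminorm ℝ (Vec d)) : EReal :=
  ⨆ (X : Type u) (_ : MeasurableSpace X), regret n Θ (lossFamily X γ 1)

/-- `θ` is a run of the diagonally scaled gradient method with `Λ = diag(lam)` on the losses
`f_0, …, f_{n-1}`, from the starting point `0`, with some choice of subgradients `g_i`:
`θ_{i+1} = θ_i - Λ⁻¹ g_i`. Here `Λ⁻¹` is the pseudo-inverse: as `a / 0 = 0`, a coordinate with
`lam j = 0` never moves. -/
def IsDiagScaledRun {d n : ℕ} (lam : Vec d) (f : Fin n → Vec d → ℝ) (θ : ℕ → Vec d) : Prop :=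
  θ 0 = 0 ∧ ∀ i : Fin n, ∃ g ∈ subdifferential (f i) (θ i),
    θ (i + 1) = fun j => θ i j - g j / lam j

end MinimaxGeometry

end

noncomputable section

namespace MinimaxGeometry

variable {d : ℕ}

/-! Let `φ` be the supremum of `γ*` over `Θ`. By sign flips `∑ √(u_j v_j) ≤ φ` for all `u` in `Θ²`
and `v` in the squared unit ball of `γ`. Quadratic convexity makes both sets convex, so the
first-order conditions at a maximiser `(a, b)` of this sum linearise it: `μ_j = √(b_j / a_j)`
satisfies `∑ μ_j u_j ≤ φ` and `∑ v_j / μ_j ≤ φ`. These two sums are exactly what the regret of the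
gradient method scaled by `√n μ` consists of, and each contributes at most `√n φ / 2`
(`exists_diagonal_scaling`, `sum_dotProduct_sub_le`). A procedure in the minimax regret must be
measurable, so there subgradients come from a measurable approximate oracle
(`exists_measurable_approx_subgradient`).

Risk is at most regret by averaging the online decisions and applying Jensen. Unbounded decisions
could spoil the integrability, so the regret is taken on a sample space enlarged by linear losses,
where finite regret forces bounded decisions (`exists_decision_bound`).

The lower bound is Assouad's method: for `t ∈ Θ` and `γ g ≤ 1` with nonnegative entries, the losses
`∑ g_k |θ_k - x_k t_k|` with random signs `x_k` of mean `±1 / (2√n)` encode one sign test per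
coordinate. No estimator errs with average probability below 1/4, and each error costs `g_k t_k /
(2√n)`. -/

theorem exists_mem_subdifferential {f : Vec d → ℝ} (hf : ConvexOn ℝ Set.univ f) (θ : Vec d) :
    (subdifferential f θ).Nonempty := by
  have hcont : Continuous f := hf.locallyLipschitz.continuous
  have hconv : Convex ℝ {p : Vec d × ℝ | f p.1 < p.2} := by
    have := hf.convex_strict_epigraph
    simpa using this
  have hopen : IsOpen {p : Vec d × ℝ | f p.1 < p.2} :=
    isOpen_lt (hcont.comp continuous_fst) continuous_snd
  -- The functional separating `(θ, f θ)` from the open strict epigraph has vertical part `c < 0`;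
  -- dividing its horizontal part by `-c` gives a subgradient.
  obtain ⟨G, hG⟩ := geometric_hahn_banach_open_point (x := (θ, f θ)) hconv hopen (by simp)
  have hsplit : ∀ x t, G (x, t) = G (x, 0) + t * G (0, 1) := by
    intro x t
    have : (x, t) = (x, (0 : ℝ)) + t • ((0 : Vec d), (1 : ℝ)) := by simp
    rw [this, map_add, map_smul, smul_eq_mul]
  set c := G (0, 1) with hc
  have hneg : c < 0 := by
    have := hG (θ, f θ + 1) (by simp)
    rw [hsplit, hsplit θ (f θ)] at this
    linarith
  have hle : ∀ x, G (x, 0) + f x * c ≤ G (θ, 0) + f θ * c := by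
    intro x
    refine le_of_forall_pos_le_add fun ε hε => ?_
    have := hG (x, f x + ε / (-c)) (by simp [div_pos hε (neg_pos.2 hneg)])
    rw [hsplit, hsplit θ (f θ), add_mul] at this
    have h2 : ε / (-c) * c = -ε := by
      rw [div_neg, neg_mul, div_mul_cancel₀ _ hneg.ne]
    linarith
  have hrep : ∀ x, G (x, 0) = (fun j => G (Pi.single j 1, 0)) ⬝ᵥ x := by
    intro x
    have : (x, (0 : ℝ)) = ∑ j, x j • ((Pi.single j 1 : Vec d), (0 : ℝ)) := by
      ext i
      · simp [Prod.fst_sum, Finset.sum_apply, Pi.single_apply]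
      · simp [Prod.snd_sum]
    rw [this, map_sum, dotProduct]
    exact Finset.sum_congr rfl fun j _ => by rw [map_smul, smul_eq_mul, mul_comm]
  refine ⟨(-c)⁻¹ • fun j => G (Pi.single j 1, 0), fun τ => ?_⟩
  rw [smul_dotProduct, dotProduct_sub, ← hrep, ← hrep, smul_eq_mul]
  have h := hle τ
  have h3 : (-c)⁻¹ * (G (τ, 0) - G (θ, 0)) ≤ (-c)⁻¹ * ((-c) * (f τ - f θ)) :=
    mul_le_mul_of_nonneg_left (by linarith) (inv_nonneg.2 (by linarith))
  rw [inv_mul_cancel_left₀ (by linarith)] at h3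
  linarith

theorem continuous_seminorm (γ : Seminorm ℝ (Vec d)) : Continuous γ :=
  γ.convexOn.locallyLipschitz.continuous

/-! ### Orthosymmetric norms and their duals -/

section Norm

variable {γ : Seminorm ℝ (Vec d)}

/-- An orthosymmetric norm is monotone in the absolute values of the coordinates. -/
theorem OrthosymmetricNorm.mono (hγo : OrthosymmetricNorm γ) {g h : Vec d}
    (hgh : ∀ j, |h j| ≤ |g j|) : γ h ≤ γ g := by
  classical
  have key : ∀ s : Finset (Fin d), γ (fun j => if j ∈ s then h j else g j) ≤ γ g := by
    intro s
    induction s using Finset.induction_on with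
    | empty => simp
    | insert a s ha ih =>
      set v : Vec d := fun j => if j ∈ s then h j else g j with hv
      obtain ⟨t, ht, hat⟩ : ∃ t : ℝ, |t| ≤ 1 ∧ h a = t * g a := by
        by_cases h0 : g a = 0
        · refine ⟨0, by simp, ?_⟩
          have := hgh a
          rw [h0, abs_zero] at this
          simpa using this
        · refine ⟨h a / g a, ?_, by field_simp⟩
          rw [abs_div]
          exact div_le_one_of_le₀ (hgh a) (abs_nonneg _)
      have hflip := hγo (fun j => if j = a then -1 else 1) v (fun j => by
        by_cases hj : j = a <;> simp [hj])
      -- Scaling one coordinate by `t ∈ [-1, 1]` is a convex combination, with weights `(1 ± t) /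
      -- 2`, of `v` and its reflection in that coordinate.
      have hdecomp : (fun j => if j ∈ insert a s then h j else g j) =
          ((1 + t) / 2) • v + ((1 - t) / 2) • fun j => (if j = a then -1 else 1) * v j := by
        ext j
        by_cases hj : j = a
        · subst hj
          simp [hv, ha, hat]
          ring
        · simp only [Finset.mem_insert, hj, false_or, hv, Pi.add_apply, Pi.smul_apply, smul_eq_mul,
            if_false]
          ring
      rw [hdecomp]
      have h1 := abs_le.1 ht
      refine (map_add_le_add γ _ _).trans ?_
      rw [map_smul_eq_mul, map_smul_eq_mul, hflip, Real.norm_of_nonneg (by linarith),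
        Real.norm_of_nonneg (by linarith)]
      linarith
  simpa using key Finset.univ

/-- Monotonicity gives `|v_j| γ(e_j) ≤ γ v`, and `γ(e_j) > 0` for a norm. -/
theorem IsNorm.exists_abs_le (hγ : IsNorm γ) (hγo : OrthosymmetricNorm γ) :
    ∃ R : ℝ, 0 < R ∧ ∀ v : Vec d, γ v ≤ 1 → ∀ j, |v j| ≤ R := by
  classical
  have hpos : ∀ j, 0 < γ (Pi.single j 1) := fun j => by
    refine lt_of_le_of_ne (apply_nonneg γ _) fun h => ?_
    have := congrFun (hγ _ h.symm) j
    simp at this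
  refine ⟨1 + ∑ j, (γ (Pi.single j 1))⁻¹, ?_, fun v hv j => ?_⟩
  · have : 0 ≤ ∑ j, (γ (Pi.single j 1))⁻¹ := Finset.sum_nonneg fun j _ => inv_nonneg.2 (hpos j).le
    linarith
  · have h1 : γ (v j • Pi.single j 1) ≤ γ v := hγo.mono fun k => by
      by_cases hk : k = j
      · subst hk; simp
      · simp [hk]
    rw [map_smul_eq_mul, Real.norm_eq_abs] at h1
    have h2 : |v j| ≤ (γ (Pi.single j 1))⁻¹ := by
      rw [← one_div, le_div_iff₀ (hpos j)]
      linarith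
    have h3 := Finset.single_le_sum (f := fun j => (γ (Pi.single j 1))⁻¹)
      (fun j _ => inv_nonneg.2 (hpos j).le) (Finset.mem_univ j)
    linarith

theorem isCompact_unitBall (hγ : IsNorm γ) (hγo : OrthosymmetricNorm γ) :
    IsCompact {v : Vec d | γ v ≤ 1} := by
  obtain ⟨R, hR, hb⟩ := hγ.exists_abs_le hγo
  refine Metric.isCompact_of_isClosed_isBounded
    (isClosed_le (continuous_seminorm γ) continuous_const) ?_
  refine (Metric.isBounded_closedBall (x := (0 : Vec d)) (r := R)).subset fun v hv => ?_
  rw [mem_closedBall_zero_iff, pi_norm_le_iff_of_nonneg hR.le]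
  exact hb v hv

theorem dotProduct_le_dualNorm (hγ : IsNorm γ) (hγo : OrthosymmetricNorm γ) {g : Vec d}
    (hg : γ g ≤ 1) (z : Vec d) : g ⬝ᵥ z ≤ dualNorm γ z := by
  refine le_csSup ?_ ⟨g, hg, rfl⟩
  exact ((isCompact_unitBall hγ hγo).image (by fun_prop)).bddAbove

theorem exists_abs_dotProduct_le (hγ : IsNorm γ) (hγo : OrthosymmetricNorm γ) :
    ∃ L : ℝ, 0 ≤ L ∧ ∀ g : Vec d, γ g ≤ 1 → ∀ z, |g ⬝ᵥ z| ≤ L * ‖z‖ := by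
  obtain ⟨R, hR, hb⟩ := hγ.exists_abs_le hγo
  refine ⟨∑ _j : Fin d, R, Finset.sum_nonneg fun _ _ => hR.le, fun g hg z => ?_⟩
  rw [dotProduct, Finset.sum_mul]
  refine (Finset.abs_sum_le_sum_abs _ _).trans (Finset.sum_le_sum fun j _ => ?_)
  rw [abs_mul]
  exact mul_le_mul (hb g hg j) (norm_le_pi_norm z j) (abs_nonneg _) hR.le

variable {Θ : Set (Vec d)}

theorem dotProduct_le_sSup (hγ : IsNorm γ) (hγo : OrthosymmetricNorm γ) (hΘc : IsCompact Θ)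
    {g θ : Vec d} (hg : γ g ≤ 1) (hθ : θ ∈ Θ) : g ⬝ᵥ θ ≤ sSup (dualNorm γ '' Θ) := by
  refine (dotProduct_le_dualNorm hγ hγo hg θ).trans (le_csSup ?_ ⟨θ, hθ, rfl⟩)
  obtain ⟨L, hL, hLb⟩ := exists_abs_dotProduct_le hγ hγo
  obtain ⟨B, hB⟩ := hΘc.isBounded.exists_norm_le
  refine ⟨L * B, ?_⟩
  rintro _ ⟨z, hz, rfl⟩
  refine csSup_le ⟨_, 0, by simp, rfl⟩ ?_
  rintro _ ⟨x, hx, rfl⟩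
  exact ((le_abs_self _).trans (hLb x hx z)).trans (mul_le_mul_of_nonneg_left (hB z hz) hL)

/-- Flipping signs so that all products of coordinates are nonnegative. -/
theorem sum_abs_mul_abs_le_sSup (hγ : IsNorm γ) (hγo : OrthosymmetricNorm γ) (hΘc : IsCompact Θ)
    {g θ : Vec d} (hg : γ g ≤ 1) (hθ : θ ∈ Θ) :
    ∑ j, |g j| * |θ j| ≤ sSup (dualNorm γ '' Θ) := by
  have h : γ (fun j => |g j| * SignType.sign (θ j)) ≤ 1 := (hγo.mono fun j => by
    rw [abs_mul, abs_abs]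
    refine mul_le_of_le_one_right (abs_nonneg _) ?_
    rcases lt_trichotomy (θ j) 0 with h | h | h <;> simp [h]).trans hg
  refine le_trans (le_of_eq ?_) (dotProduct_le_sSup hγ hγo hΘc h hθ)
  simp only [dotProduct, mul_assoc, sign_mul_self]

end Norm

/-! ### Lipschitz continuity of the losses -/

section Losses

variable {γ : Seminorm ℝ (Vec d)}

theorem ConvexLosses.abs_sub_le {f : Vec d → ℝ} {r L : ℝ} (hf : f ∈ ConvexLosses γ r)
    (hL : ∀ g : Vec d, γ g ≤ r → ∀ z, |g ⬝ᵥ z| ≤ L * ‖z‖) (a b : Vec d) :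
    |f a - f b| ≤ L * ‖a - b‖ := by
  have key : ∀ a b, f a - f b ≤ L * ‖a - b‖ := fun a b => by
    obtain ⟨g, hg⟩ := exists_mem_subdifferential hf.1 a
    have h1 := hg b
    have h2 := hL g (hf.2 a g hg) (b - a)
    rw [norm_sub_rev] at h2
    have := neg_abs_le (g ⬝ᵥ (b - a))
    linarith
  rw [abs_le]
  have h1 := key a b
  have h2 := key b a
  rw [norm_sub_rev] at h2
  constructor <;> linarith

theorem ConvexLosses.continuous {f : Vec d → ℝ} {r : ℝ} (hf : f ∈ ConvexLosses γ r) :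
    Continuous f := hf.1.locallyLipschitz.continuous

end Losses

/-! ### The diagonal scaling from a saddle point -/

section Saddle

open Filter Topology

/-- First-order condition at the maximiser `a`: the derivative at 0 along the segment towards `u` is
nonpositive, and it is half the difference of the two sides. -/
theorem sum_sqrt_div_mul_le {a b u : Vec d} (ha : ∀ j, 0 < a j) (hb : ∀ j, 0 < b j)
    (hmax : ∀ t ∈ Set.Icc (0 : ℝ) 1,
      ∑ j, √((a j + t * (u j - a j)) * b j) ≤ ∑ j, √(a j * b j)) :
    ∑ j, √(b j / a j) * u j ≤ ∑ j, √(a j * b j) := by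
  have hab : ∀ j, 0 < a j * b j := fun j => mul_pos (ha j) (hb j)
  have hd : HasDerivAt (fun t : ℝ => ∑ j, √((a j + t * (u j - a j)) * b j))
      (∑ j, (u j - a j) * b j / (2 * √(a j * b j))) 0 := by
    refine HasDerivAt.fun_sum fun j _ => ?_
    have h1 : HasDerivAt (fun t : ℝ => (a j + t * (u j - a j)) * b j) ((u j - a j) * b j) 0 := by
      have := ((((hasDerivAt_id (0 : ℝ)).mul_const (u j - a j)).const_add (a j)).mul_const (b j))
      simpa using this
    have h2 := h1.sqrt (by simpa using (hab j).ne')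
    simpa using h2
  have hle : ∑ j, (u j - a j) * b j / (2 * √(a j * b j)) ≤ 0 := by
    refine le_of_tendsto hd.tendsto_slope_zero_right ?_
    filter_upwards [Ioc_mem_nhdsGT (zero_lt_one (α := ℝ))] with t ht
    have := hmax t ⟨ht.1.le, ht.2⟩
    simp only [zero_add, zero_mul, add_zero, smul_eq_mul]
    exact mul_nonpos_of_nonneg_of_nonpos (inv_nonneg.2 ht.1.le) (by linarith)
  have hterm : ∀ j, (u j - a j) * b j / (2 * √(a j * b j)) =
      (√(b j / a j) * u j - √(a j * b j)) / 2 := fun j => by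
    have hsa := Real.sqrt_pos.2 (ha j)
    have hsb := Real.sqrt_pos.2 (hb j)
    rw [Real.sqrt_div (hb j).le, Real.sqrt_mul (ha j).le]
    have e1 := Real.sq_sqrt (ha j).le
    have e2 := Real.sq_sqrt (hb j).le
    set x := √(a j)
    set y := √(b j)
    rw [← e1, ← e2]
    field_simp
  simp only [hterm] at hle
  rw [← Finset.sum_div, Finset.sum_sub_distrib] at hle
  linarith

/-- A saddle point of `∑ √(a_j b_j)` over compact convex sets of positive vectors. -/
theorem exists_scaling_of_pos {A B : Set (Vec d)} (hA : IsCompact A) (hB : IsCompact B)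
    (hAc : Convex ℝ A) (hBc : Convex ℝ B) (hAn : A.Nonempty) (hBn : B.Nonempty)
    (hA0 : ∀ a ∈ A, ∀ j, 0 < a j) (hB0 : ∀ b ∈ B, ∀ j, 0 < b j) :
    ∃ a ∈ A, ∃ b ∈ B, ∃ μ : Vec d, (∀ j, 0 < μ j) ∧
      (∀ u ∈ A, ∑ j, μ j * u j ≤ ∑ j, √(a j * b j)) ∧
      (∀ v ∈ B, ∑ j, v j / μ j ≤ ∑ j, √(a j * b j)) := by
  obtain ⟨⟨a, b⟩, ⟨ha, hb⟩, hmax⟩ := (hA.prod hB).exists_isMaxOn (hAn.prod hBn)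
    (f := fun p : Vec d × Vec d => ∑ j, √(p.1 j * p.2 j)) (by fun_prop)
  have hseg : ∀ {S : Set (Vec d)}, Convex ℝ S → ∀ x ∈ S, ∀ y ∈ S, ∀ t ∈ Set.Icc (0 : ℝ) 1,
      (fun j => x j + t * (y j - x j)) ∈ S := fun hS x hx y hy t ht => by
    have := hS hx hy (sub_nonneg.2 ht.2) ht.1 (by ring)
    convert this using 1
    ext j
    simp
    ring
  -- Varying `a` produces the weights `√(b_j / a_j)`, varying `b` their inverses `√(a_j / b_j)`;
  -- hence one `μ` serves both sets.
  refine ⟨a, ha, b, hb, fun j => √(b j / a j),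
    fun j => Real.sqrt_pos.2 (div_pos (hB0 b hb j) (hA0 a ha j)), fun u hu => ?_, fun v hv => ?_⟩
  · exact sum_sqrt_div_mul_le (hA0 a ha) (hB0 b hb) fun t ht =>
      hmax (show ((fun j => a j + t * (u j - a j)), b) ∈ A ×ˢ B from ⟨hseg hAc a ha u hu t ht, hb⟩)
  · have := sum_sqrt_div_mul_le (u := v) (hB0 b hb) (hA0 a ha) fun t ht => by
      have := hmax (show (a, (fun j => b j + t * (v j - b j))) ∈ A ×ˢ B from
        ⟨ha, hseg hBc b hb v hv t ht⟩)
      simpa only [Set.mem_ofPred_eq, mul_comm (a _)] using this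
    simp only [mul_comm (b _)] at this
    refine le_trans (le_of_eq (Finset.sum_congr rfl fun j _ => ?_)) this
    rw [div_eq_inv_mul, ← Real.sqrt_inv, inv_div]

theorem sqrt_add_le {x y : ℝ} (hx : 0 ≤ x) (hy : 0 ≤ y) : √(x + y) ≤ √x + √y := by
  refine Real.sqrt_le_iff.2 ⟨by positivity, ?_⟩
  have := mul_nonneg (Real.sqrt_nonneg x) (Real.sqrt_nonneg y)
  rw [add_sq, Real.sq_sqrt hx, Real.sq_sqrt hy]
  linarith

/-- Translating both sets by `ε` in every coordinate makes them positive. As `√` is subadditive,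
this raises `∑ √(u_j v_j)` by an amount that vanishes with `ε`. -/
theorem exists_scaling_le_add {K V : Set (Vec d)} (hK : IsCompact K) (hV : IsCompact V)
    (hKc : Convex ℝ K) (hVc : Convex ℝ V) (hKn : K.Nonempty) (hVn : V.Nonempty)
    (hK0 : ∀ u ∈ K, ∀ j, 0 ≤ u j) (hV0 : ∀ v ∈ V, ∀ j, 0 ≤ v j) {φ : ℝ}
    (hφ : ∀ u ∈ K, ∀ v ∈ V, ∑ j, √(u j * v j) ≤ φ) {δ : ℝ} (hδ : 0 < δ) :
    ∃ μ : Vec d, (∀ j, 0 < μ j) ∧ (∀ u ∈ K, ∑ j, μ j * u j ≤ φ + δ) ∧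
      (∀ v ∈ V, ∑ j, v j / μ j ≤ φ + δ) := by
  obtain ⟨B₁, hB₁⟩ := hK.isBounded.exists_norm_le
  obtain ⟨B₂, hB₂⟩ := hV.isBounded.exists_norm_le
  obtain ⟨ε, hε, hεδ⟩ : ∃ ε : ℝ, 0 < ε ∧ ∑ _j : Fin d, √(ε * (B₁ + B₂ + ε)) < δ := by
    have hc : Continuous fun ε : ℝ => ∑ _j : Fin d, √(ε * (B₁ + B₂ + ε)) := by fun_prop
    have hlim := hc.tendsto 0
    simp only [zero_mul, Real.sqrt_zero, Finset.sum_const_zero] at hlim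
    have := (hlim.mono_left (nhdsWithin_le_nhds (s := Set.Ioi (0 : ℝ)))).eventually (gt_mem_nhds hδ)
    obtain ⟨ε, h1, h2⟩ := (this.and (self_mem_nhdsWithin (s := Set.Ioi (0 : ℝ)))).exists
    exact ⟨ε, h2, h1⟩
  set e : Vec d := fun _ => ε with he
  obtain ⟨_, ⟨a, ha, rfl⟩, _, ⟨b, hb, rfl⟩, μ, hμ, h1, h2⟩ := exists_scaling_of_pos
    (A := (fun x => e + x) '' K) (B := (fun x => e + x) '' V)
    (hK.image (by fun_prop)) (hV.image (by fun_prop)) (hKc.translate e) (hVc.translate e)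
    (hKn.image _) (hVn.image _)
    (by rintro _ ⟨x, hx, rfl⟩ j; exact add_pos_of_pos_of_nonneg hε (hK0 x hx j))
    (by rintro _ ⟨x, hx, rfl⟩ j; exact add_pos_of_pos_of_nonneg hε (hV0 x hx j))
  have hbound : ∑ j, √((e + a) j * (e + b) j) ≤ φ + δ := by
    have : ∀ j, √((e + a) j * (e + b) j) ≤ √(a j * b j) + √(ε * (B₁ + B₂ + ε)) := fun j => by
      have ha0 := hK0 a ha j
      have hb0 := hV0 b hb j
      have ha1 := (le_abs_self _).trans ((norm_le_pi_norm a j).trans (hB₁ a ha))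
      have hb1 := (le_abs_self _).trans ((norm_le_pi_norm b j).trans (hB₂ b hb))
      refine le_trans (Real.sqrt_le_sqrt ?_) (sqrt_add_le
        (mul_nonneg ha0 hb0) (mul_nonneg hε.le (by linarith)))
      have : (e + a) j * (e + b) j = a j * b j + ε * (a j + b j + ε) := by
        simp only [he, Pi.add_apply]; ring
      rw [this]
      have := mul_le_mul_of_nonneg_left (show a j + b j + ε ≤ B₁ + B₂ + ε by linarith) hε.le
      linarith
    refine (Finset.sum_le_sum fun j _ => this j).trans ?_
    rw [Finset.sum_add_distrib]
    linarith [hφ a ha b hb]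
  refine ⟨μ, hμ, fun u hu => ?_, fun v hv => ?_⟩
  · refine le_trans (Finset.sum_le_sum fun j _ => ?_) ((h1 _ ⟨u, hu, rfl⟩).trans hbound)
    exact mul_le_mul_of_nonneg_left (by simp [he, hε.le]) (hμ j).le
  · refine le_trans (Finset.sum_le_sum fun j _ => ?_) ((h2 _ ⟨v, hv, rfl⟩).trans hbound)
    exact div_le_div_of_nonneg_right (by simp [he, hε.le]) (hμ j).le

/-- A limit of the approximate scalings as the error tends to 0, along a convergent subsequence. -/
theorem exists_scaling {K V : Set (Vec d)} (hK : IsCompact K) (hV : IsCompact V)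
    (hKc : Convex ℝ K) (hVc : Convex ℝ V) (hKn : K.Nonempty) (hVn : V.Nonempty)
    (hK0 : ∀ u ∈ K, ∀ j, 0 ≤ u j) (hV0 : ∀ v ∈ V, ∀ j, 0 ≤ v j)
    (hVp : ∀ j, ∃ v ∈ V, 0 < v j) {φ : ℝ}
    (hφ : ∀ u ∈ K, ∀ v ∈ V, ∑ j, √(u j * v j) ≤ φ) :
    ∃ μ : Vec d, (∀ j, 0 ≤ μ j) ∧ (∀ j, (∃ u ∈ K, 0 < u j) → 0 < μ j) ∧
      (∀ u ∈ K, ∑ j, μ j * u j ≤ φ) ∧ (∀ v ∈ V, ∑ j, v j / μ j ≤ φ) := by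
  classical
  have hφ0 : 0 ≤ φ := by
    obtain ⟨u, hu⟩ := hKn
    obtain ⟨v, hv⟩ := hVn
    exact (Finset.sum_nonneg fun j _ => Real.sqrt_nonneg _).trans (hφ u hu v hv)
  have hex : ∀ k : ℕ, ∃ μ : Vec d, (∀ j, 0 < μ j) ∧ (∀ u ∈ K, ∑ j, μ j * u j ≤ φ + 1 / (k + 1)) ∧
      (∀ v ∈ V, ∑ j, v j / μ j ≤ φ + 1 / (k + 1)) := fun k =>
    exists_scaling_le_add hK hV hKc hVc hKn hVn hK0 hV0 hφ (by positivity)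
  choose μ hμ hμK hμV using hex
  have hk1 : ∀ k : ℕ, (1 : ℝ) / (k + 1) ≤ 1 := fun k => by
    rw [div_le_one (by positivity)]; linarith [k.cast_nonneg (α := ℝ)]
  set I : Set (Fin d) := {j | ∃ u ∈ K, 0 < u j} with hI
  -- Where `K` vanishes, `μ k j` may be unbounded in `k`. Replacing it by 0 only decreases both
  -- sums, since `v / 0 = 0`. The other coordinates are confined to a compact interval of positive
  -- numbers by the two inequalities themselves.
  set ν : ℕ → Vec d := fun k j => if j ∈ I then μ k j else 0 with hν
  have hbox : ∀ j, ∃ l h : ℝ, (j ∈ I → 0 < l) ∧ 0 ≤ l ∧ ∀ k, ν k j ∈ Set.Icc l h := by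
    intro j
    by_cases hj : j ∈ I
    · obtain ⟨u, hu, huj⟩ := hj
      obtain ⟨v, hv, hvj⟩ := hVp j
      have hl : 0 < v j / (φ + 1) := by positivity
      refine ⟨v j / (φ + 1), (φ + 1) / u j, fun _ => hl, hl.le, fun k => ?_⟩
      have hνj : ν k j = μ k j := if_pos ⟨u, hu, huj⟩
      rw [hνj]
      constructor
      · have h1 := Finset.single_le_sum (f := fun j => v j / μ k j)
          (fun i _ => div_nonneg (hV0 v hv i) (hμ k i).le) (Finset.mem_univ j)
        have h2 : v j / μ k j ≤ φ + 1 := h1.trans ((hμV k v hv).trans (by linarith [hk1 k]))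
        rw [div_le_iff₀ (hμ k j)] at h2
        rw [div_le_iff₀ (by positivity)]
        linarith
      · have h1 := Finset.single_le_sum (f := fun j => μ k j * u j)
          (fun i _ => mul_nonneg (hμ k i).le (hK0 u hu i)) (Finset.mem_univ j)
        rw [le_div_iff₀ huj]
        exact h1.trans ((hμK k u hu).trans (by linarith [hk1 k]))
    · exact ⟨0, 0, fun h => absurd h hj, le_rfl, fun k => by simp [hν, hj]⟩
  choose l h hl hl0 hlh using hbox
  obtain ⟨m, hm, σ, hσ, hlim⟩ := (isCompact_univ_pi fun j => isCompact_Icc (a := l j) (b := h j)).tendsto_subseq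
    (x := ν) fun k j _ => hlh j k
  have hlimj : ∀ j, Tendsto (fun k => ν (σ k) j) atTop (𝓝 (m j)) := fun j =>
    (tendsto_pi_nhds.1 hlim) j
  have hlimφ : Tendsto (fun k : ℕ => φ + 1 / ((σ k : ℝ) + 1)) atTop (𝓝 φ) := by
    have := (tendsto_one_div_add_atTop_nhds_zero_nat (𝕜 := ℝ)).comp hσ.tendsto_atTop
    simpa using this.const_add φ
  refine ⟨m, fun j => (hl0 j).trans (hm j trivial).1, fun j hj => (hl j hj).trans_le (hm j trivial).1,
    fun u hu => ?_, fun v hv => ?_⟩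
  · refine le_of_tendsto_of_tendsto' (tendsto_finsetSum _ fun j _ => (hlimj j).mul_const (u j))
      hlimφ fun k => le_trans (Finset.sum_le_sum fun j _ => ?_) (hμK (σ k) u hu)
    refine mul_le_mul_of_nonneg_right ?_ (hK0 u hu j)
    by_cases hj : j ∈ I <;> simp [hν, hj, (hμ _ _).le]
  · refine le_of_tendsto_of_tendsto' (f := fun k => ∑ j, v j / ν (σ k) j)
      (tendsto_finsetSum _ fun j _ => ?_)
      hlimφ fun k => le_trans (Finset.sum_le_sum fun j _ => ?_) (hμV (σ k) v hv)
    · by_cases hj : j ∈ I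
      · exact tendsto_const_nhds.div (hlimj j) ((hl j hj).trans_le (hm j trivial).1).ne'
      · have h0 : ∀ k, ν k j = 0 := fun k => by simp [hν, hj]
        have hm0 : m j = 0 := tendsto_nhds_unique (hlimj j) (by simp [h0])
        simp [h0, hm0]
    · by_cases hj : j ∈ I
      · simp [hν, hj]
      · simp [hν, hj, div_nonneg (hV0 v hv j) (hμ _ _).le]

end Saddle

/-- Quadratic convexity is convexity of the sets of squares, and on squares `∑ √(u_j v_j)` becomes
`∑ |θ_j| |g_j|`, which orthosymmetry bounds by the supremum of the dual norm. -/
theorem exists_diagonal_scaling {Θ : Set (Vec d)} {γ : Seminorm ℝ (Vec d)}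
    (hΘne : Θ.Nonempty) (hΘc : IsCompact Θ) (hΘq : QuadConvex Θ)
    (hγ : IsNorm γ) (hγo : OrthosymmetricNorm γ) (hγq : QuadConvexNorm γ) :
    ∃ μ : Vec d, (∀ j, 0 ≤ μ j) ∧ (∀ j, (∃ θ ∈ Θ, θ j ≠ 0) → 0 < μ j) ∧
      (∀ θ ∈ Θ, ∑ j, μ j * θ j ^ 2 ≤ sSup (dualNorm γ '' Θ)) ∧
      (∀ g, γ g ≤ 1 → ∑ j, g j ^ 2 / μ j ≤ sSup (dualNorm γ '' Θ)) := by
  have hcont : Continuous (coordSq (d := d)) := by unfold coordSq; fun_prop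
  obtain ⟨μ, h0, hpos, hK, hV⟩ := exists_scaling (K := coordSq '' Θ)
    (V := coordSq '' {v | γ v ≤ 1}) (hΘc.image hcont) ((isCompact_unitBall hγ hγo).image hcont)
    hΘq hγq (hΘne.image _) ⟨_, 0, by simp, rfl⟩
    (by rintro _ ⟨x, -, rfl⟩ j; exact sq_nonneg _) (by rintro _ ⟨x, -, rfl⟩ j; exact sq_nonneg _)
    (fun j => by
      classical
      have hne : γ (Pi.single j 1) ≠ 0 := fun h => by
        have := congrFun (hγ _ h) j
        simp at this
      refine ⟨_, ⟨(γ (Pi.single j 1))⁻¹ • Pi.single j 1, ?_, rfl⟩, ?_⟩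
      · rw [Set.mem_ofPred_eq, map_smul_eq_mul, norm_inv, Real.norm_of_nonneg (apply_nonneg _ _),
          inv_mul_cancel₀ hne]
      · simp only [coordSq, Pi.smul_apply, Pi.single_eq_same, smul_eq_mul, mul_one]
        positivity)
    (φ := sSup (dualNorm γ '' Θ)) (by
      rintro _ ⟨θ, hθ, rfl⟩ _ ⟨g, hg, rfl⟩
      refine le_trans (le_of_eq (Finset.sum_congr rfl fun j _ => ?_))
        (sum_abs_mul_abs_le_sSup hγ hγo hΘc hg hθ)
      rw [coordSq, coordSq, Real.sqrt_mul (sq_nonneg _), Real.sqrt_sq_eq_abs,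
        Real.sqrt_sq_eq_abs, mul_comm])
  refine ⟨μ, h0, fun j => ?_, fun θ hθ => hK _ ⟨θ, hθ, rfl⟩, fun g hg => hV _ ⟨g, hg, rfl⟩⟩
  rintro ⟨θ, hθ, hj⟩
  exact hpos j ⟨_, ⟨θ, hθ, rfl⟩, by simp only [coordSq]; positivity⟩

/-! ### Regret of the scaled gradient method -/

section GradientMethod

theorem sum_mul_sub_le_of_scaled_steps {n : ℕ} {lam τ : ℝ} {g θ : ℕ → ℝ} (hlam : 0 ≤ lam)
    (hτ : lam = 0 → τ = 0) (h0 : θ 0 = 0) (hstep : ∀ i < n, θ (i + 1) = θ i - g i / lam) :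
    ∑ i ∈ Finset.range n, g i * (θ i - τ) ≤
      lam * τ ^ 2 / 2 + ∑ i ∈ Finset.range n, g i ^ 2 / lam / 2 := by
  rcases hlam.eq_or_lt with hl | hl
  · have hz : ∀ i ≤ n, θ i = 0 := fun i => by
      induction i with
      | zero => exact fun _ => h0
      | succ k ih => intro hk; rw [hstep k hk, ih (by omega), ← hl]; simp
    have : ∑ i ∈ Finset.range n, g i * (θ i - τ) = 0 := Finset.sum_eq_zero fun i hi => by
      rw [hz i (Finset.mem_range.1 hi).le, hτ hl.symm]; simp
    rw [this, ← hl]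
    simp
  -- Expanding the square of a step shows that the potential `lam (θ - τ)² / 2` telescopes with
  -- equality.
  · have key : ∀ m ≤ n, ∑ i ∈ Finset.range m, g i * (θ i - τ) + lam * (θ m - τ) ^ 2 / 2 =
        lam * τ ^ 2 / 2 + ∑ i ∈ Finset.range m, g i ^ 2 / lam / 2 := fun m => by
      induction m with
      | zero => intro _; simp [h0]
      | succ k ih =>
        intro hk
        rw [Finset.sum_range_succ, Finset.sum_range_succ, ← add_assoc, ← ih (by omega),
          hstep k hk]
        field_simp
        ring
    have := key n le_rfl
    have h2 : 0 ≤ lam * (θ n - τ) ^ 2 / 2 := by positivity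
    linarith

/-- The regret of the gradient method on linear losses, with the scaling `√n μ`. -/
theorem sum_dotProduct_sub_le {n : ℕ} {γ : Seminorm ℝ (Vec d)} {φ : ℝ} {μ τ : Vec d}
    {g θ : ℕ → Vec d} (hμ : ∀ j, 0 ≤ μ j) (hτ : ∀ j, τ j ≠ 0 → 0 < μ j)
    (hμτ : ∑ j, μ j * τ j ^ 2 ≤ φ) (hμg : ∀ g, γ g ≤ 1 → ∑ j, g j ^ 2 / μ j ≤ φ)
    (hg : ∀ i < n, γ (g i) ≤ 1) (h0 : θ 0 = 0)
    (hstep : ∀ i < n, θ (i + 1) = fun j => θ i j - g i j / (√n * μ j)) :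
    ∑ i ∈ Finset.range n, g i ⬝ᵥ (θ i - τ) ≤ √n * φ := by
  rcases Nat.eq_zero_or_pos n with rfl | hn
  · simp
  have hs : 0 < √(n : ℝ) := Real.sqrt_pos.2 (by exact_mod_cast hn)
  have hcoord : ∀ j, ∑ i ∈ Finset.range n, g i j * (θ i j - τ j) ≤
      √n * μ j * τ j ^ 2 / 2 + ∑ i ∈ Finset.range n, g i j ^ 2 / (√n * μ j) / 2 := fun j =>
    sum_mul_sub_le_of_scaled_steps (g := fun i => g i j) (θ := fun i => θ i j)
      (mul_nonneg hs.le (hμ j)) (fun h => by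
        by_contra hne
        exact (mul_pos hs (hτ j hne)).ne' h) (by simp [h0]) (fun i hi => by simp [hstep i hi])
  calc ∑ i ∈ Finset.range n, g i ⬝ᵥ (θ i - τ)
      = ∑ j, ∑ i ∈ Finset.range n, g i j * (θ i j - τ j) := by
        rw [Finset.sum_comm]; rfl
    _ ≤ ∑ j, (√n * μ j * τ j ^ 2 / 2 + ∑ i ∈ Finset.range n, g i j ^ 2 / (√n * μ j) / 2) :=
        Finset.sum_le_sum fun j _ => hcoord j
    _ = √n / 2 * ∑ j, μ j * τ j ^ 2 +
          (2 * √n)⁻¹ * ∑ i ∈ Finset.range n, ∑ j, g i j ^ 2 / μ j := by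
        rw [Finset.sum_add_distrib, Finset.sum_comm, Finset.mul_sum, Finset.mul_sum]
        congr 1
        · exact Finset.sum_congr rfl fun j _ => by ring
        · refine Finset.sum_congr rfl fun i _ => ?_
          rw [Finset.mul_sum]
          refine Finset.sum_congr rfl fun j _ => ?_
          rw [div_div, div_eq_mul_inv, div_eq_mul_inv, mul_inv, mul_inv, mul_inv]
          ring
    -- The factor `√n` in the scaling balances the distance term and the gradient term at `√n φ / 2`
    -- each.
    _ ≤ √n / 2 * φ + (2 * √n)⁻¹ * (n * φ) := by
        have h1 : ∑ i ∈ Finset.range n, ∑ j, g i j ^ 2 / μ j ≤ n * φ := by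
          refine (Finset.sum_le_sum fun i hi => hμg _ (hg i (Finset.mem_range.1 hi))).trans ?_
          simp
        gcongr
    _ = √n * φ := by
        have : (n : ℝ) = √n * √n := (Real.mul_self_sqrt (by positivity)).symm
        nth_rewrite 3 [this]
        field_simp
        ring

theorem one_div_mul_le_one_div_sqrt_mul {n : ℕ} (hn : 1 ≤ n) {s φ : ℝ} (h : s ≤ √n * φ) :
    1 / (n : ℝ) * s ≤ 1 / √(n : ℝ) * φ := by
  have hn0 : (0 : ℝ) < n := by exact_mod_cast hn
  refine (mul_le_mul_of_nonneg_left h (by positivity)).trans (le_of_eq ?_)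
  have : (n : ℝ) = √n * √n := (Real.mul_self_sqrt hn0.le).symm
  nth_rewrite 1 [this]
  have hs := Real.sqrt_pos.2 hn0
  field_simp

theorem regret_le_of_isDiagScaledRun {n : ℕ} (hn : 1 ≤ n) {γ : Seminorm ℝ (Vec d)} {φ : ℝ}
    {μ τ : Vec d} (hμ : ∀ j, 0 ≤ μ j) (hτ : ∀ j, τ j ≠ 0 → 0 < μ j)
    (hμτ : ∑ j, μ j * τ j ^ 2 ≤ φ) (hμg : ∀ g, γ g ≤ 1 → ∑ j, g j ^ 2 / μ j ≤ φ)
    {f : Fin n → Vec d → ℝ} (hf : ∀ i, f i ∈ ConvexLosses γ 1) {θ : ℕ → Vec d}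
    (hrun : IsDiagScaledRun (fun j => √n * μ j) f θ) :
    (1 / (n : ℝ)) * ∑ i : Fin n, (f i (θ i) - f i τ) ≤ 1 / √(n : ℝ) * φ := by
  obtain ⟨h0, hstep⟩ := hrun
  choose g hg hθ using hstep
  set G : ℕ → Vec d := fun i => if h : i < n then g ⟨i, h⟩ else 0 with hG
  have hGi : ∀ i : Fin n, G i = g i := fun i => by simp [hG]
  have hmain := sum_dotProduct_sub_le (n := n) (g := G) hμ hτ hμτ hμg (fun i hi => by
      rw [hGi ⟨i, hi⟩]; exact (hf _).2 _ _ (hg ⟨i, hi⟩)) h0 (fun i hi => by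
      rw [hGi ⟨i, hi⟩]; exact hθ ⟨i, hi⟩)
  have hle : ∑ i : Fin n, (f i (θ i) - f i τ) ≤ √n * φ := by
    refine le_trans ?_ hmain
    rw [Finset.sum_range]
    refine Finset.sum_le_sum fun i _ => ?_
    have h1 := hg i τ
    rw [hGi, ← neg_sub τ, dotProduct_neg]
    linarith
  exact one_div_mul_le_one_div_sqrt_mul hn hle

end GradientMethod

/-! ### A measurable subgradient oracle -/

section Oracle

/-- The least good index is measurable; accepting every index when none is good keeps the search
total. -/
theorem exists_measurable_nat_choice {α : Type*} [MeasurableSpace α] {p : α → ℕ → Prop}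
    (hp : ∀ k, MeasurableSet {x | p x k}) :
    ∃ s : α → ℕ, Measurable s ∧ ∀ x, (∃ k, p x k) → p x (s x) := by
  classical
  have hex : ∀ x, ∃ k, p x k ∨ ∀ l, ¬ p x l := fun x => by
    by_cases h : ∃ k, p x k
    · exact h.imp fun k hk => Or.inl hk
    · exact ⟨0, Or.inr (not_exists.1 h)⟩
  refine ⟨fun x => Nat.find (hex x), measurable_find hex fun k => ?_, fun x hx => ?_⟩
  · refine (hp k).union ?_
    have : {x | ∀ l, ¬ p x l} = ⋂ l, {x | p x l}ᶜ := by ext; simp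
    refine (congrArg MeasurableSet this).mpr ?_
    exact MeasurableSet.iInter fun l => (hp l).compl
  · exact (Nat.find_spec (hex x)).resolve_right fun h => hx.elim fun k hk => h k hk

theorem abs_dotProduct_le_card_mul (x z : Vec d) : |x ⬝ᵥ z| ≤ d * ‖x‖ * ‖z‖ := by
  refine (Finset.abs_sum_le_sum_abs _ _).trans ?_
  refine (Finset.sum_le_sum (g := fun _ => ‖x‖ * ‖z‖) fun j _ => ?_).trans (by simp [mul_assoc])
  rw [abs_mul]
  exact mul_le_mul (norm_le_pi_norm x j) (norm_le_pi_norm z j) (abs_nonneg _) (norm_nonneg _)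

/-- Up to an arbitrarily small error, subgradients can be chosen measurably in the loss and the
point, if the loss is evaluated at a measurable rounding of the point. -/
theorem exists_measurable_approx_subgradient {γ : Seminorm ℝ (Vec d)} {Θ : Set (Vec d)}
    (hΘne : Θ.Nonempty) (hΘc : IsCompact Θ) (hγ : IsNorm γ) (hγo : OrthosymmetricNorm γ)
    {ε : ℝ} (hε : 0 < ε) :
    ∃ (q : Vec d → Vec d) (G : (Vec d → ℝ) × Vec d → Vec d), Measurable q ∧ Measurable G ∧
      (∀ p, γ (G p) ≤ 1) ∧ ∀ f ∈ ConvexLosses γ 1, ∀ θ, ∀ τ ∈ Θ,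
        f (q θ) - f τ ≤ G (f, θ) ⬝ᵥ (θ - τ) + ε := by
  obtain ⟨L, hL0, hL⟩ := exists_abs_dotProduct_le hγ hγo
  obtain ⟨B, hB⟩ := hΘc.isBounded.exists_norm_le
  have : Nonempty Θ := hΘne.to_subtype
  have : Nonempty {v : Vec d | γ v ≤ 1} := ⟨⟨0, by simp⟩⟩
  set a : ℕ → Vec d := fun k => (TopologicalSpace.denseSeq {v : Vec d | γ v ≤ 1} k : Vec d)
  have ha : ∀ k, γ (a k) ≤ 1 := fun k => (TopologicalSpace.denseSeq {v : Vec d | γ v ≤ 1} k).2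
  set D : ℕ → Θ := TopologicalSpace.denseSeq Θ
  -- Everything is made countable: slopes `a`, comparators `D`, and grid points `c` to which `θ` is
  -- rounded. Rounding within `ε / (2 (L + 1))` costs at most `ε / 2`; the other `ε / 2` pays for a
  -- slope from the dense sequence.
  set c : ℕ → Vec d := TopologicalSpace.denseSeq (Vec d)
  obtain ⟨ρ, hρm, hρ⟩ := exists_measurable_nat_choice
    (p := fun (θ : Vec d) k => dist θ (c k) < ε / (2 * (L + 1)))
    fun k => measurableSet_lt (by fun_prop) measurable_const
  have hρd : ∀ θ, ‖c (ρ θ) - θ‖ < ε / (2 * (L + 1)) := fun θ => by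
    rw [← dist_eq_norm, dist_comm]
    exact hρ θ ((TopologicalSpace.denseRange_denseSeq (Vec d)).exists_dist_lt θ (by positivity))
  have hsel : ∀ i, ∃ s : (Vec d → ℝ) → ℕ, Measurable s ∧ ∀ f,
      (∃ k, ∀ m, f (c i) + a k ⬝ᵥ ((D m : Vec d) - c i) ≤ f (D m) + ε / 2) →
      ∀ m, f (c i) + a (s f) ⬝ᵥ ((D m : Vec d) - c i) ≤ f (D m) + ε / 2 := fun i => by
    refine exists_measurable_nat_choice fun k => ?_
    rw [Set.ofPred_forall]
    exact MeasurableSet.iInter fun m => measurableSet_le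
      ((measurable_pi_apply _).add_const _) ((measurable_pi_apply _).add_const _)
  choose s hsm hs using hsel
  -- Joint measurability in loss and point needs only measurability in the loss for each of the
  -- countably many grid indices.
  have hHm : Measurable fun p : (Vec d → ℝ) × ℕ => a (s p.2 p.1) :=
    measurable_from_prod_countable_left fun i => (measurable_from_nat (f := a)).comp (hsm i)
  refine ⟨fun θ => c (ρ θ), fun p => a (s (ρ p.2) p.1), (measurable_from_nat (f := c)).comp hρm,
    hHm.comp (measurable_fst.prodMk (hρm.comp measurable_snd)), fun p => ha _,
    fun f hf θ τ hτ => ?_⟩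
  have hex : ∃ k, ∀ m, f (c (ρ θ)) + a k ⬝ᵥ ((D m : Vec d) - c (ρ θ)) ≤ f (D m) + ε / 2 := by
    obtain ⟨g, hg⟩ := exists_mem_subdifferential hf.1 (c (ρ θ))
    have hB0 : 0 ≤ B := (norm_nonneg _).trans (hB τ hτ)
    -- `M` bounds `d ‖D m - c (ρ θ)‖` uniformly in `m`, so one slope close enough to `g` works for
    -- all comparators.
    set M := d * (B + ‖c (ρ θ)‖) + 1 with hM
    have hM0 : 0 < M := by positivity
    obtain ⟨k, hk⟩ := (TopologicalSpace.denseRange_denseSeq {v : Vec d | γ v ≤ 1}).exists_dist_lt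
      ⟨g, hf.2 _ g hg⟩ (show 0 < ε / (2 * M) by positivity)
    have hk' : ‖a k - g‖ < ε / (2 * M) := by
      rw [← dist_eq_norm, dist_comm]; exact hk
    refine ⟨k, fun m => ?_⟩
    have h1 := hg (D m)
    have h2 := (le_abs_self _).trans (abs_dotProduct_le_card_mul (a k - g) ((D m : Vec d) - c (ρ θ)))
    have h3 : ‖(D m : Vec d) - c (ρ θ)‖ ≤ B + ‖c (ρ θ)‖ :=
      (norm_sub_le _ _).trans (add_le_add_left (hB _ (D m).2) _)
    have h4 : d * ‖a k - g‖ * ‖(D m : Vec d) - c (ρ θ)‖ ≤ ε / 2 := by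
      calc d * ‖a k - g‖ * ‖(D m : Vec d) - c (ρ θ)‖
          = ‖a k - g‖ * (d * ‖(D m : Vec d) - c (ρ θ)‖) := by ring
        _ ≤ ε / (2 * M) * M := by
            refine mul_le_mul hk'.le ?_ (by positivity) (by positivity)
            have := mul_le_mul_of_nonneg_left h3 (Nat.cast_nonneg (α := ℝ) d)
            linarith
        _ = ε / 2 := by field_simp
    rw [sub_dotProduct] at h2
    linarith
  -- Both sides are continuous in the comparator, so the inequality passes from the dense sequence
  -- to all of `Θ`.
  have hall : f (c (ρ θ)) + a (s (ρ θ) f) ⬝ᵥ (τ - c (ρ θ)) ≤ f τ + ε / 2 := by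
    have hcl : IsClosed {x : Θ | f (c (ρ θ)) + a (s (ρ θ) f) ⬝ᵥ ((x : Vec d) - c (ρ θ)) ≤
        f x + ε / 2} := by
      have hfc := ConvexLosses.continuous hf
      exact isClosed_le (by fun_prop) (by fun_prop)
    exact (TopologicalSpace.denseRange_denseSeq Θ).induction_on (p := fun x : Θ =>
      f (c (ρ θ)) + a (s (ρ θ) f) ⬝ᵥ ((x : Vec d) - c (ρ θ)) ≤ f x + ε / 2) ⟨τ, hτ⟩ hcl
      (hs _ f hex)
  have hround : a (s (ρ θ) f) ⬝ᵥ (c (ρ θ) - θ) ≤ ε / 2 := by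
    refine (le_abs_self _).trans ((hL _ (ha _) _).trans ?_)
    calc L * ‖c (ρ θ) - θ‖ ≤ (L + 1) * (ε / (2 * (L + 1))) :=
          mul_le_mul (by linarith) (hρd θ).le (norm_nonneg _) (by positivity)
      _ = ε / 2 := by field_simp
  rw [dotProduct_sub] at hall hround ⊢
  linarith

end Oracle

/-! ### Upper bound for the minimax regret -/

section RegretUpperBound

/-- The iterates of the scaled gradient method, driven by the subgradient oracle `G`, as a function
of the losses observed so far. -/
def gradientIterate (lam : Vec d) (G : (Vec d → ℝ) × Vec d → Vec d) :
    (i : ℕ) → (Fin i → Vec d → ℝ) → Vec d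
  | 0, _ => 0
  | i + 1, o => fun j =>
      gradientIterate lam G i (fun k => o k.castSucc) j -
        G (o (Fin.last i), gradientIterate lam G i (fun k => o k.castSucc)) j / lam j

theorem measurable_gradientIterate (lam : Vec d) {G : (Vec d → ℝ) × Vec d → Vec d}
    (hG : Measurable G) (i : ℕ) : Measurable (gradientIterate lam G i) := by
  induction i with
  | zero => exact measurable_const
  | succ i ih =>
    have h1 : Measurable fun o : Fin (i + 1) → Vec d → ℝ =>
        gradientIterate lam G i (fun k => o k.castSucc) :=
      ih.comp (measurable_pi_lambda _ fun k => measurable_pi_apply _)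
    have h2 : Measurable fun o : Fin (i + 1) → Vec d → ℝ =>
        G (o (Fin.last i), gradientIterate lam G i (fun k => o k.castSucc)) :=
      hG.comp ((measurable_pi_apply _).prodMk h1)
    refine measurable_pi_lambda _ fun j => ?_
    exact ((measurable_pi_apply j).comp h1).sub (((measurable_pi_apply j).comp h2).div_const _)

theorem minimaxRegret_le {n : ℕ} (hn : 1 ≤ n) {Θ : Set (Vec d)} {γ : Seminorm ℝ (Vec d)}
    (hΘne : Θ.Nonempty) (hΘc : IsCompact Θ) (hγ : IsNorm γ) (hγo : OrthosymmetricNorm γ)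
    {φ : ℝ} {μ : Vec d} (hμ : ∀ j, 0 ≤ μ j) (hτ : ∀ j, (∃ θ ∈ Θ, θ j ≠ 0) → 0 < μ j)
    (hμτ : ∀ θ ∈ Θ, ∑ j, μ j * θ j ^ 2 ≤ φ) (hμg : ∀ g, γ g ≤ 1 → ∑ j, g j ^ 2 / μ j ≤ φ) :
    minimaxRegret.{u} n Θ γ ≤ ((1 / √(n : ℝ) * φ : ℝ) : EReal) := by
  refine iSup₂_le fun X _ => EReal.le_of_forall_lt_iff_le.1 fun y hy => ?_
  have hy' : 1 / √(n : ℝ) * φ < y := by exact_mod_cast hy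
  -- The oracle error is the gap between `y` and the bound. The procedure plays the rounded point `q
  -- θ_i`, while the recursion runs on the unrounded `θ_i`.
  obtain ⟨q, G, hq, hG, hG1, hGf⟩ := exists_measurable_approx_subgradient hΘne hΘc hγ hγo
    (sub_pos.2 hy')
  set lam : Vec d := fun j => √n * μ j with hlam
  refine (iInf_le _ ⟨fun i o => q (gradientIterate lam G i fun k => (o k).2), fun i =>
    hq.comp ((measurable_gradientIterate lam hG i).comp
      (measurable_pi_lambda _ fun k => measurable_snd.comp (measurable_pi_apply k)))⟩).trans ?_
  refine iSup₂_le fun F hF => iSup_le fun x => iSup₂_le fun τ hτΘ => ?_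
  rw [EReal.coe_le_coe_iff]
  set f : ℕ → Vec d → ℝ := fun k => if h : k < n then fun θ => F θ (x ⟨k, h⟩) else 0 with hf
  have hfi : ∀ i : Fin n, f i = fun θ => F θ (x i) := fun i => by simp [hf]
  set θ : ℕ → Vec d := fun i => gradientIterate lam G i fun k => f k with hθ
  have hobs : ∀ i : Fin n, (gradientIterate lam G i fun k =>
      (observe F (x (Fin.castLE i.2.le k))).2) = θ i := fun i => by
    simp only [hθ, observe]
    congr 1
    ext1 k
    exact (hfi (Fin.castLE i.2.le k)).symm
  have hmain := sum_dotProduct_sub_le (n := n) (g := fun i => G (f i, θ i)) (θ := θ) (τ := τ) hμ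
    (fun j hj => hτ j ⟨τ, hτΘ, hj⟩) (hμτ τ hτΘ) hμg (fun i _ => hG1 _) rfl (fun i _ => rfl)
  have hsum : ∑ i : Fin n, (F (q (θ i)) (x i) - F τ (x i)) ≤
      √n * φ + n * (y - 1 / √(n : ℝ) * φ) := by
    rw [Finset.sum_range] at hmain
    have : ∑ i : Fin n, (F (q (θ i)) (x i) - F τ (x i)) ≤
        ∑ i : Fin n, (G (f i, θ i) ⬝ᵥ (θ i - τ) + (y - 1 / √(n : ℝ) * φ)) :=
      Finset.sum_le_sum fun i _ => by
        have := hGf (f i) (by rw [hfi]; exact hF.1 _) (θ i) τ hτΘ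
        simpa only [hfi] using this
    rw [Finset.sum_add_distrib] at this
    simp only [Finset.sum_const, Finset.card_univ, Fintype.card_fin, nsmul_eq_mul] at this
    linarith
  simp only [hobs]
  have hn0 : (0 : ℝ) < n := by exact_mod_cast hn
  have h1 := one_div_mul_le_one_div_sqrt_mul hn
    (s := ∑ i : Fin n, (F (q (θ i)) (x i) - F τ (x i)) - n * (y - 1 / √(n : ℝ) * φ)) (φ := φ)
    (by linarith)
  rw [mul_sub, ← mul_assoc (1 / (n : ℝ)) (n : ℝ), one_div_mul_cancel hn0.ne'] at h1
  linarith

end RegretUpperBound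

/-! ### Stochastic risk is at most regret -/

section OnlineToBatch

theorem expectation_eq_integral {Ω : Type*} [MeasurableSpace Ω] {μ : Measure Ω} {Y : Ω → ℝ}
    (hY : Integrable Y μ) : expectation μ Y = ((∫ ω, Y ω ∂μ : ℝ) : EReal) := by
  have h1 : (∫⁻ ω, ENNReal.ofReal (Y ω) ∂μ) ≠ ⊤ := hY.lintegral_lt_top.ne
  have h2 : (∫⁻ ω, ENNReal.ofReal (-Y ω) ∂μ) ≠ ⊤ := hY.neg.lintegral_lt_top.ne
  rw [expectation, if_neg h1, integral_eq_lintegral_pos_part_sub_lintegral_neg_part hY,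
    EReal.coe_sub, EReal.coe_ennreal_toReal h1, EReal.coe_ennreal_toReal h2]

theorem subdifferential_dotProduct (h θ : Vec d) :
    subdifferential (fun θ => h ⬝ᵥ θ) θ = {h} := by
  ext g
  simp only [subdifferential, Set.mem_ofPred_eq, Set.mem_singleton_iff]
  refine ⟨fun hg => ?_, fun hg τ => by rw [hg, dotProduct_sub]; linarith⟩
  have h1 := hg (θ + (g - h))
  rw [add_sub_cancel_left, dotProduct_add] at h1
  have h2 : (g - h) ⬝ᵥ (g - h) ≤ 0 := by
    rw [sub_dotProduct]; linarith
  have h3 : 0 ≤ (g - h) ⬝ᵥ (g - h) := Finset.sum_nonneg fun j _ => mul_self_nonneg _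
  exact sub_eq_zero.1 (dotProduct_self_eq_zero.1 (le_antisymm h2 h3))

theorem convexOn_dotProduct (h : Vec d) : ConvexOn ℝ Set.univ fun θ : Vec d => h ⬝ᵥ θ :=
  ⟨convex_univ, fun x _ y _ a b _ _ _ => by
    simp only [dotProduct_add, dotProduct_smul, smul_eq_mul, le_refl]⟩

/-- The extension of a family of losses on `X` by all linear losses in the class: a sample space
on which the adversary can punish any large decision. -/
def extendLosses {X : Type u} (γ : Seminorm ℝ (Vec d)) (F : Vec d → X → ℝ) :
    Vec d → X ⊕ ULift.{u} (Vec d) → ℝ :=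
  open Classical in
  fun θ => Sum.elim (F θ) fun g => (if γ g.down ≤ 1 then g.down else 0) ⬝ᵥ θ

theorem extendLosses_mem {X : Type u} [MeasurableSpace X] {γ : Seminorm ℝ (Vec d)}
    {F : Vec d → X → ℝ} (hF : F ∈ lossFamily X γ 1) :
    extendLosses γ F ∈ lossFamily (X ⊕ ULift.{u} (Vec d)) γ 1 := by
  refine ⟨fun x => ?_, fun θ => (hF.2 θ).sumElim ?_⟩
  · rcases x with x | g
    · exact hF.1 x
    · refine ⟨convexOn_dotProduct _, fun θ h hh => ?_⟩
      rw [show h = _ from (subdifferential_dotProduct _ θ).subset hh]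
      split_ifs with hg
      · exact hg
      · simp
  · have hm : Measurable fun g : ULift.{u} (Vec d) => if γ g.down ≤ 1 then g.down else 0 :=
      Measurable.ite (measurableSet_le ((continuous_seminorm γ).measurable.comp measurable_down)
        measurable_const) measurable_down measurable_const
    have hc : Continuous fun v : Vec d => v ⬝ᵥ θ := by fun_prop
    exact hc.measurable.comp hm

/-- A signed multiple of a basis vector: a linear loss in the class whose value at `v` charges the
coordinate `v j`. The `+ 1` in `K` keeps the divisor positive. -/
theorem exists_aligned {γ : Seminorm ℝ (Vec d)} :
    ∃ K : ℝ, 0 ≤ K ∧ ∀ (v : Vec d) (j : Fin d), ∃ g : Vec d, γ g ≤ 1 ∧ |v j| ≤ K * (g ⬝ᵥ v) := by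
  classical
  have hS : 0 ≤ ∑ j, γ (Pi.single j 1) := Finset.sum_nonneg fun j _ => apply_nonneg _ _
  set K := ∑ j, γ (Pi.single j 1) + 1 with hK
  have hK0 : 0 < K := by linarith
  refine ⟨K, hK0.le, fun v j => ⟨((SignType.sign (v j) : ℝ) / K) • Pi.single j 1, ?_, ?_⟩⟩
  · rw [map_smul_eq_mul, Real.norm_eq_abs, abs_div, abs_of_pos hK0, div_mul_eq_mul_div,
      div_le_one hK0]
    have h1 : |(SignType.sign (v j) : ℝ)| ≤ 1 := by
      rcases lt_trichotomy (v j) 0 with h | h | h <;> simp [h]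
    have h2 := Finset.single_le_sum (f := fun j => γ (Pi.single j (1 : ℝ) : Vec d))
      (fun j _ => apply_nonneg _ _) (Finset.mem_univ j)
    have h3 := mul_le_mul_of_nonneg_right h1 (apply_nonneg γ (Pi.single j 1))
    linarith
  · rw [smul_dotProduct, single_dotProduct, smul_eq_mul, one_mul, div_mul_eq_mul_div,
      sign_mul_self, mul_div_cancel₀ _ hK0.ne']

variable {n : ℕ} {Θ : Set (Vec d)} {γ : Seminorm ℝ (Vec d)}

/-- A finite regret on the extended sample space forces uniformly bounded decisions. -/
theorem exists_decision_bound {X : Type u} [MeasurableSpace X] {M : ℝ} {θ₀ : Vec d}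
    (hγ : IsNorm γ) (hγo : OrthosymmetricNorm γ)
    (a : (i : Fin n) → (Fin i.1 → Obs d (X ⊕ ULift.{u} (Vec d))) → Vec d)
    (hreg : ∀ F ∈ lossFamily (X ⊕ ULift.{u} (Vec d)) γ 1, ∀ x : Fin n → X ⊕ ULift.{u} (Vec d),
      ∑ i : Fin n, (F (a i fun k => observe F (x (Fin.castLE i.2.le k))) (x i) - F θ₀ (x i)) ≤ M) :
    ∃ B : ℝ, 0 ≤ B ∧ ∀ F ∈ lossFamily X γ 1, ∀ (x : Fin n → X) (i : Fin n),
      ‖a i fun k => observe (extendLosses γ F) (Sum.inl (x (Fin.castLE i.2.le k)))‖ ≤ B := by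
  classical
  obtain ⟨L, hL0, hL⟩ := exists_abs_dotProduct_le hγ hγo
  obtain ⟨K, hK0, hK⟩ := exists_aligned (γ := γ)
  -- Induction on the round, with a bound uniform in `F` and `x`: earlier rounds contribute at least
  -- `-C` each by the Lipschitz bound and the induction hypothesis.
  have step : ∀ m : ℕ, ∃ B : ℝ, 0 ≤ B ∧ ∀ F ∈ lossFamily X γ 1, ∀ (x : Fin n → X) (i : Fin n),
      i.1 < m →
      ‖a i fun k => observe (extendLosses γ F) (Sum.inl (x (Fin.castLE i.2.le k)))‖ ≤ B := by
    intro m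
    induction m with
    | zero => exact ⟨0, le_rfl, fun _ _ _ i hi => absurd hi (Nat.not_lt_zero _)⟩
    | succ m ih =>
      obtain ⟨B, hB0, hB⟩ := ih
      set C := L * (B + ‖θ₀‖) with hC
      have hC0 : 0 ≤ C := by positivity
      have hB' : 0 ≤ K * (|M| + L * ‖θ₀‖ + n * C) := by positivity
      refine ⟨max B (K * (|M| + L * ‖θ₀‖ + n * C)), le_max_of_le_left hB0, fun F hF x i hi => ?_⟩
      rcases (Nat.lt_succ_iff_lt_or_eq.1 hi) with him | him
      · exact (hB F hF x i him).trans (le_max_left _ _)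
      refine le_trans ?_ (le_max_right _ _)
      rw [pi_norm_le_iff_of_nonneg hB']
      intro j
      set v := a i fun k => observe (extendLosses γ F) (Sum.inl (x (Fin.castLE i.2.le k))) with hv
      obtain ⟨g, hg, hgv⟩ := hK v j
      -- The adversary follows `x` before round `i`, plays the aligned linear loss at round `i`, and
      -- zero losses afterwards. Decisions up to round `i` do not notice the change.
      set x' : Fin n → X ⊕ ULift.{u} (Vec d) := fun k =>
        if k < i then Sum.inl (x k) else if k = i then Sum.inr ⟨g⟩ else Sum.inr ⟨0⟩ with hx'
      have hobs : ∀ k : Fin n, k ≤ i →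
          (a k fun l => observe (extendLosses γ F) (x' (Fin.castLE k.2.le l))) =
          a k fun l => observe (extendLosses γ F) (Sum.inl (x (Fin.castLE k.2.le l))) := by
        intro k hk
        congr 1
        ext1 l
        have : Fin.castLE k.2.le l < i := lt_of_lt_of_le (show Fin.castLE k.2.le l < k from l.2) hk
        simp only [hx', if_pos this]
      have hsum := hreg _ (extendLosses_mem hF) x'
      rw [← Finset.add_sum_erase _ _ (Finset.mem_univ i)] at hsum
      have hi' : x' i = Sum.inr ⟨g⟩ := by simp [hx']
      have hterm : extendLosses γ F (a i fun k =>
          observe (extendLosses γ F) (x' (Fin.castLE i.2.le k))) (x' i) -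
          extendLosses γ F θ₀ (x' i) = g ⬝ᵥ v - g ⬝ᵥ θ₀ := by
        rw [hobs i le_rfl, hi']
        simp [extendLosses, hg, hv]
      have hrest : -(n * C) ≤ ∑ k ∈ Finset.univ.erase i, (extendLosses γ F (a k fun l =>
          observe (extendLosses γ F) (x' (Fin.castLE k.2.le l))) (x' k) -
          extendLosses γ F θ₀ (x' k)) := by
        have hle : ∀ k ∈ Finset.univ.erase i, -C ≤ extendLosses γ F (a k fun l =>
          observe (extendLosses γ F) (x' (Fin.castLE k.2.le l))) (x' k) -
          extendLosses γ F θ₀ (x' k) := by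
          intro k hk
          have hki : k ≠ i := Finset.ne_of_mem_erase hk
          by_cases hlt : k < i
          · rw [hobs k hlt.le]
            have hk' : x' k = Sum.inl (x k) := by simp [hx', hlt]
            rw [hk']
            have h1 := hB F hF x k (by rw [← him]; exact hlt)
            have h2 := ConvexLosses.abs_sub_le (hF.1 (x k)) hL
              (a k fun l => observe (extendLosses γ F) (Sum.inl (x (Fin.castLE k.2.le l)))) θ₀
            have h3 := mul_le_mul_of_nonneg_left
              ((norm_sub_le (a k fun l => observe (extendLosses γ F)
                (Sum.inl (x (Fin.castLE k.2.le l)))) θ₀).trans (add_le_add_left h1 _)) hL0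
            exact (abs_le.1 (h2.trans h3)).1
          · have hk' : x' k = Sum.inr ⟨0⟩ := by simp [hx', hlt, hki]
            rw [hk']
            simp [extendLosses, hC0]
        have h1 := Finset.card_nsmul_le_sum _ _ _ hle
        refine le_trans ?_ h1
        rw [Finset.card_erase_of_mem (Finset.mem_univ i), Finset.card_univ, Fintype.card_fin,
          nsmul_eq_mul, mul_neg, neg_le_neg_iff]
        exact mul_le_mul_of_nonneg_right (by exact_mod_cast Nat.sub_le n 1) hC0
      rw [hterm] at hsum
      have h5 := (le_abs_self _).trans (hL g hg θ₀)
      have h6 := le_abs_self M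
      rw [Real.norm_eq_abs]
      exact hgv.trans (mul_le_mul_of_nonneg_left (by linarith) hK0)
  obtain ⟨B, hB0, hB⟩ := step n
  exact ⟨B, hB0, fun F hF x i => hB F hF x i i.2⟩

/-- Under a product measure, a function of `x_i` and of the coordinates before `i` has the same
mean as its average over an independent copy of `x_i`. -/
theorem integral_pi_eq_integral_integral {X E : Type*} [MeasurableSpace X] [MeasurableSpace E]
    (P : Measure X) [IsProbabilityMeasure P] (i : Fin n) {h : (Fin i.1 → X) → E}
    (hh : Measurable h) {D : E → X → ℝ} (hD : Measurable (Function.uncurry D)) {C : ℝ}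
    (hC : ∀ y z, |D (h y) z| ≤ C) :
    ∫ x, D (h fun k => x (Fin.castLE i.2.le k)) (x i) ∂(Measure.pi fun _ : Fin n => P) =
      ∫ x, (∫ z, D (h fun k => x (Fin.castLE i.2.le k)) z ∂P)
        ∂(Measure.pi fun _ : Fin n => P) := by
  obtain ⟨m, rfl⟩ : ∃ m, n = m + 1 := ⟨n - 1, by have := i.2; omega⟩
  have hmp := measurePreserving_piFinSuccAbove (fun _ : Fin (m + 1) => P) i
  -- After coordinate `i` is split off, the remaining coordinates are independent of it, and the
  -- first `i` of them are the ones before `i`.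
  set ι : (Fin m → X) → Fin i.1 → X := fun r k => r ⟨k, by have := i.2; have := k.2; omega⟩ with hι
  have hιm : Measurable ι := measurable_pi_lambda _ fun k => measurable_pi_apply _
  have hcast : ∀ x : Fin (m + 1) → X, (fun k => x (Fin.castLE i.2.le k)) =
      ι (MeasurableEquiv.piFinSuccAbove (fun _ => X) i x).2 := fun x => by
    ext1 k
    have hk := k.2
    have : Fin.castLE i.2.le k = i.succAbove ⟨k, by omega⟩ := by
      rw [Fin.succAbove_of_castSucc_lt _ _ (by simp [Fin.lt_def])]
      rfl
    simp only [this]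
    rfl
  have hm1 : Measurable fun p : X × (Fin m → X) => D (h (ι p.2)) p.1 :=
    hD.comp ((hh.comp (hιm.comp measurable_snd)).prodMk measurable_fst)
  have hi1 : Integrable (fun p : X × (Fin m → X) => D (h (ι p.2)) p.1)
      (P.prod (Measure.pi fun _ : Fin m => P)) :=
    Integrable.of_bound hm1.aestronglyMeasurable C (Filter.Eventually.of_forall fun p => hC _ _)
  have hm2 : StronglyMeasurable fun r : Fin m → X => ∫ z, D (h (ι r)) z ∂P :=
    StronglyMeasurable.integral_prod_right'
      (f := fun p : (Fin m → X) × X => D (h (ι p.1)) p.2)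
      (hD.comp ((hh.comp (hιm.comp measurable_fst)).prodMk measurable_snd)).stronglyMeasurable
  have e1 : ∫ x, D (h fun k => x (Fin.castLE i.2.le k)) (x i)
      ∂(Measure.pi fun _ : Fin (m + 1) => P) =
      ∫ r, (∫ z, D (h (ι r)) z ∂P) ∂(Measure.pi fun _ : Fin m => P) := by
    rw [← integral_prod_symm _ hi1, ← hmp.integral_comp' ]
    exact integral_congr_ae (Filter.Eventually.of_forall fun x => by
      simp only [hcast]; rfl)
  rw [e1]
  have e2 : ∫ x, (∫ z, D (h fun k => x (Fin.castLE i.2.le k)) z ∂P)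
        ∂(Measure.pi fun _ : Fin (m + 1) => P) =
      ∫ p : X × (Fin m → X), (∫ z, D (h (ι p.2)) z ∂P)
        ∂(P.prod (Measure.pi fun _ : Fin m => P)) := by
    rw [← hmp.integral_comp']
    exact integral_congr_ae (Filter.Eventually.of_forall fun x => by
      simp only [hcast])
  rw [e2, integral_fun_snd (fun r => ∫ z, D (h (ι r)) z ∂P)]
  simp

theorem convexOn_expLoss {X : Type u} [MeasurableSpace X] {F : Vec d → X → ℝ} {r : ℝ}
    (hF : F ∈ lossFamily X γ r) {P : ProbabilityMeasure X}
    (hint : ∀ θ, Integrable (F θ) (P : Measure X)) : ConvexOn ℝ Set.univ (expLoss F P) := by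
  refine ⟨convex_univ, fun x _ y _ a b ha hb hab => ?_⟩
  simp only [expLoss, smul_eq_mul]
  rw [← integral_const_mul, ← integral_const_mul,
    ← integral_add ((hint x).const_mul a) ((hint y).const_mul b)]
  exact integral_mono (hint _) (((hint x).const_mul a).add ((hint y).const_mul b))
    fun z => (hF.1 z).1.2 (Set.mem_univ x) (Set.mem_univ y) ha hb hab

/-- Online-to-batch conversion for bounded decisions. -/
theorem expectation_average_le {X : Type u} [MeasurableSpace X] (hn : 1 ≤ n)
    (hΘne : Θ.Nonempty) (hΘc : IsCompact Θ) (hγ : IsNorm γ) (hγo : OrthosymmetricNorm γ)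
    {F : Vec d → X → ℝ} (hF : F ∈ lossFamily X γ 1) {P : ProbabilityMeasure X}
    (hint : ∀ θ, Integrable (F θ) (P : Measure X))
    {h : (i : Fin n) → (Fin i.1 → X) → Vec d} (hh : ∀ i, Measurable (h i)) {B M : ℝ}
    (hB : ∀ i y, ‖h i y‖ ≤ B)
    (hM : ∀ x : Fin n → X, ∀ θ ∈ Θ, (1 / (n : ℝ)) *
      ∑ i : Fin n, (F (h i fun k => x (Fin.castLE i.2.le k)) (x i) - F θ (x i)) ≤ M) :
    expectation (Measure.pi fun _ : Fin n => (P : Measure X))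
      (fun x => expLoss F P ((1 / (n : ℝ)) • ∑ i : Fin n, h i fun k => x (Fin.castLE i.2.le k)) -
        sInf (expLoss F P '' Θ)) ≤ (M : EReal) := by
  have hn0 : (0 : ℝ) < n := by exact_mod_cast hn
  have hcx := convexOn_expLoss hF hint
  have hcont : Continuous (expLoss F P) := hcx.locallyLipschitz.continuous
  obtain ⟨θ, hθ, hmin⟩ := hΘc.exists_isMinOn hΘne hcont.continuousOn
  have hinf : sInf (expLoss F P '' Θ) = expLoss F P θ :=
    IsLeast.csInf_eq ⟨⟨θ, hθ, rfl⟩, by rintro _ ⟨τ, hτ, rfl⟩; exact hmin hτ⟩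
  rw [hinf]
  obtain ⟨L, hL0, hL⟩ := exists_abs_dotProduct_le hγ hγo
  set Q : Measure (Fin n → X) := Measure.pi fun _ : Fin n => (P : Measure X) with hQ
  set H : Fin n → (Fin n → X) → Vec d := fun i x => h i fun k => x (Fin.castLE i.2.le k) with hH
  have hHm : ∀ i, Measurable (H i) := fun i =>
    (hh i).comp (measurable_pi_lambda _ fun k => measurable_pi_apply _)
  -- `F` itself is only integrable in `x`, but differences of its values are bounded by the
  -- Lipschitz estimate.
  set D : Vec d → X → ℝ := fun τ z => F τ z - F θ z with hD
  have hDm : Measurable (Function.uncurry D) :=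
    measurable_uncurry_of_continuous_of_measurable
      (fun z => (ConvexLosses.continuous (hF.1 z)).sub continuous_const)
      (fun τ => (hF.2 τ).sub (hF.2 θ))
  have hDb : ∀ i y z, |D (h i y) z| ≤ L * (B + ‖θ‖) := fun i y z =>
    (ConvexLosses.abs_sub_le (hF.1 z) hL _ _).trans
      (mul_le_mul_of_nonneg_left ((norm_sub_le _ _).trans (add_le_add_left (hB i y) _)) hL0)
  have hDint : ∀ τ, ∫ z, D τ z ∂(P : Measure X) = expLoss F P τ - expLoss F P θ := fun τ =>
    integral_sub (hint τ) (hint θ)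
  have hcoupled : ∀ i, Integrable (fun x => D (H i x) (x i)) Q := fun i =>
    Integrable.of_bound (hDm.comp ((hHm i).prodMk (measurable_pi_apply i))).aestronglyMeasurable _
      (Filter.Eventually.of_forall fun x => hDb _ _ _)
  have hball : ∀ {g : (Fin n → X) → Vec d}, Measurable g → (∀ x, ‖g x‖ ≤ B) →
      Integrable (fun x => expLoss F P (g x) - expLoss F P θ) Q := fun {g} hg hgB => by
    obtain ⟨C, hC⟩ := ((isCompact_closedBall (0 : Vec d) B).image
      (hcont.sub (continuous_const (y := expLoss F P θ)))).isBounded.exists_norm_le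
    exact Integrable.of_bound ((hcont.measurable.comp hg).sub_const _).aestronglyMeasurable C
      (Filter.Eventually.of_forall fun x => hC _ ⟨g x, by simpa using hgB x, rfl⟩)
  have havg : ∀ x, ‖(1 / (n : ℝ)) • ∑ i, H i x‖ ≤ B := fun x => by
    rw [norm_smul, Real.norm_of_nonneg (by positivity)]
    have : ‖∑ i, H i x‖ ≤ n * B := (norm_sum_le_of_le _ fun i _ => hB i _).trans (by simp)
    calc 1 / (n : ℝ) * ‖∑ i, H i x‖ ≤ 1 / (n : ℝ) * (n * B) :=
          mul_le_mul_of_nonneg_left this (by positivity)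
      _ = B := by field_simp
  have hYint := hball ((Finset.measurable_sum Finset.univ fun i _ => hHm i).const_smul (1 / (n : ℝ)))
    (fun x => by simpa using havg x)
  simp only [Pi.smul_apply] at hYint
  have hjensen : ∀ x, expLoss F P ((1 / (n : ℝ)) • ∑ i, H i x) - expLoss F P θ ≤
      (1 / (n : ℝ)) * ∑ i, (expLoss F P (H i x) - expLoss F P θ) := fun x => by
    have := hcx.map_sum_le (t := Finset.univ) (w := fun _ : Fin n => 1 / (n : ℝ))
      (p := fun i => H i x) (fun _ _ => by positivity) (by simp [hn0.ne']) (fun _ _ => trivial)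
    rw [← Finset.smul_sum, ← Finset.smul_sum, smul_eq_mul] at this
    rw [Finset.sum_sub_distrib, mul_sub]
    simp only [Finset.sum_const, Finset.card_univ, Fintype.card_fin, nsmul_eq_mul]
    rw [← mul_assoc (1 / (n : ℝ)) (n : ℝ), one_div_mul_cancel hn0.ne', one_mul]
    linarith
  rw [expectation_eq_integral hYint, EReal.coe_le_coe_iff]
  calc ∫ x, (expLoss F P ((1 / (n : ℝ)) • ∑ i, H i x) - expLoss F P θ) ∂Q
      ≤ ∫ x, (1 / (n : ℝ)) * ∑ i, (expLoss F P (H i x) - expLoss F P θ) ∂Q :=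
        integral_mono hYint ((integrable_finsetSum _ fun i _ =>
          hball (hHm i) fun x => hB i _).const_mul _) hjensen
    _ = (1 / (n : ℝ)) * ∑ i, ∫ x, (expLoss F P (H i x) - expLoss F P θ) ∂Q := by
        rw [integral_const_mul, integral_finsetSum _ fun i _ => hball (hHm i) fun x => hB i _]
    _ = (1 / (n : ℝ)) * ∑ i, ∫ x, D (H i x) (x i) ∂Q := by
        congr 1
        refine Finset.sum_congr rfl fun i _ => ?_
        simp only [← hDint]
        -- Decision `i` depends only on earlier points, so its excess risk has the same mean as its
        -- excess loss at the fresh point `x_i`.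
        exact (integral_pi_eq_integral_integral (P : Measure X) i (hh i) hDm (hDb i)).symm
    _ = ∫ x, (1 / (n : ℝ)) * ∑ i, D (H i x) (x i) ∂Q := by
        rw [integral_const_mul, integral_finsetSum _ fun i _ => hcoupled i]
    _ ≤ ∫ _x, M ∂Q :=
        integral_mono ((integrable_finsetSum _ fun i _ => hcoupled i).const_mul _)
          (integrable_const _) fun x => hM x θ hθ
    _ = M := by simp

theorem stochasticRisk_le_of_regret_le {X : Type u} [MeasurableSpace X] (hn : 1 ≤ n)
    (hΘne : Θ.Nonempty) (hΘc : IsCompact Θ) (hγ : IsNorm γ) (hγo : OrthosymmetricNorm γ)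
    (𝓟 : Set (ProbabilityMeasure X)) {M : ℝ}
    {a : (i : Fin n) → (Fin i.1 → Obs d (X ⊕ ULift.{u} (Vec d))) → Vec d}
    (ha : ∀ i, Measurable (a i))
    (hreg : ∀ F ∈ lossFamily (X ⊕ ULift.{u} (Vec d)) γ 1,
      ∀ x : Fin n → X ⊕ ULift.{u} (Vec d), ∀ θ ∈ Θ, (1 / (n : ℝ)) * ∑ i : Fin n,
        (F (a i fun k => observe F (x (Fin.castLE i.2.le k))) (x i) - F θ (x i)) ≤ M) :
    stochasticRisk n Θ (lossFamily X γ 1) 𝓟 ≤ (M : EReal) := by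
  have hn0 : (0 : ℝ) < n := by exact_mod_cast hn
  obtain ⟨θ₀, hθ₀⟩ := hΘne
  obtain ⟨B, hB0, hB⟩ := exists_decision_bound (M := n * M) (θ₀ := θ₀) hγ hγo a fun F hF x => by
    have := mul_le_mul_of_nonneg_left (hreg F hF x θ₀ hθ₀) hn0.le
    rwa [← mul_assoc, mul_one_div_cancel hn0.ne', one_mul] at this
  -- The estimator averages the decisions on the relabelled sample. It needs no knowledge of `F`
  -- beyond the observed losses, because the extended loss agrees with `F` on the left summand.
  have hest : Measurable fun o : Fin n → Obs d X => (1 / (n : ℝ)) • ∑ i : Fin n,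
      a i fun k => (Sum.inl (o (Fin.castLE i.2.le k)).1, (o (Fin.castLE i.2.le k)).2) := by
    have hterm : ∀ i : Fin n, Measurable fun (o : Fin n → Obs d X) => a i fun k =>
        (Sum.inl (o (Fin.castLE i.2.le k)).1, (o (Fin.castLE i.2.le k)).2) := fun i =>
      (ha i).comp (measurable_pi_lambda _ fun k =>
        (measurable_inl.comp (measurable_fst.comp (measurable_pi_apply _))).prodMk
          (measurable_snd.comp (measurable_pi_apply _)))
    exact (Finset.measurable_fun_sum Finset.univ fun i _ => hterm i).const_smul (1 / (n : ℝ))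
  refine iInf_le_of_le ⟨_, hest⟩ (iSup₂_le fun F hF => iSup₂_le fun P _ => iSup_le fun hint => ?_)
  obtain ⟨x₀⟩ : Nonempty X := nonempty_of_isProbabilityMeasure (P : Measure X)
  have hobs : Measurable fun x : X =>
      observe (extendLosses γ F) (Sum.inl x : X ⊕ ULift.{u} (Vec d)) :=
    measurable_inl.prodMk (measurable_pi_lambda _ fun θ => hF.2 θ)
  refine expectation_average_le (h := fun i y => a i fun k =>
    observe (extendLosses γ F) (Sum.inl (y k))) hn ⟨θ₀, hθ₀⟩ hΘc hγ hγo hF hint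
    (fun i => (ha i).comp (measurable_pi_lambda _ fun k => hobs.comp (measurable_pi_apply k)))
    (B := B) (fun i y => ?_)
    (fun x θ hθ => hreg _ (extendLosses_mem hF) (fun i => Sum.inl (x i)) θ hθ)
  -- The bound concerns full samples, so the partial history `y` is padded with `x₀`.
  have := hB F hF (fun k => if h : k.1 < i.1 then y ⟨k, h⟩ else x₀) i
  simpa using this

theorem minimaxStochasticRisk_le_minimaxRegret (hn : 1 ≤ n)
    (hΘne : Θ.Nonempty) (hΘc : IsCompact Θ) (hγ : IsNorm γ) (hγo : OrthosymmetricNorm γ) :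
    minimaxStochasticRisk.{u} n Θ γ ≤ minimaxRegret.{u} n Θ γ := by
  refine iSup_le fun X => iSup_le fun _ => iSup_le fun 𝓟 => ?_
  refine le_trans ?_ (le_iSup₂_of_le (X ⊕ ULift.{u} (Vec d)) inferInstance le_rfl)
  refine le_iInf fun alg => ?_
  refine EReal.le_of_forall_lt_iff_le.1 fun M hM => ?_
  refine stochasticRisk_le_of_regret_le hn hΘne hΘc hγ hγo 𝓟 alg.2 fun F hF x θ hθ => ?_
  rw [← EReal.coe_le_coe_iff]
  refine le_trans ?_ hM.le
  exact le_iSup₂_of_le F hF (le_iSup_of_le x (le_iSup₂_of_le θ hθ le_rfl))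

end OnlineToBatch

/-! ### Assouad's lemma for product sign laws -/

section Assouad

/-- Cauchy–Schwarz for `√(pq) = √min √max`: with `m = ∑ min` one has `∑ max = 2 - m`, so `m (2 - m)
≥ 3 / 4` and `m ≥ 1 / 2`. -/
theorem half_le_sum_min {ι : Type*} [Fintype ι] {p q : ι → ℝ} (hp : ∀ x, 0 ≤ p x)
    (hq : ∀ x, 0 ≤ q x) (hp1 : ∑ x, p x = 1) (hq1 : ∑ x, q x = 1)
    (h : 3 / 4 ≤ (∑ x, √(p x * q x)) ^ 2) : 1 / 2 ≤ ∑ x, min (p x) (q x) := by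
  have hmin : ∀ x, 0 ≤ min (p x) (q x) := fun x => le_min (hp x) (hq x)
  have hmax : ∀ x, 0 ≤ max (p x) (q x) := fun x => le_max_of_le_left (hp x)
  have h1 : ∑ x, max (p x) (q x) = 2 - ∑ x, min (p x) (q x) := by
    rw [eq_sub_iff_add_eq, ← Finset.sum_add_distrib]
    simp only [max_add_min, Finset.sum_add_distrib, hp1, hq1]
    norm_num
  have h2 : (∑ x, √(p x * q x)) ^ 2 ≤ (∑ x, min (p x) (q x)) * ∑ x, max (p x) (q x) := by
    have hcs := Finset.sum_mul_sq_le_sq_mul_sq Finset.univ (fun x => √(min (p x) (q x)))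
      (fun x => √(max (p x) (q x)))
    simp only [← Real.sqrt_mul (hmin _), min_mul_max, Real.sq_sqrt (hmin _),
      Real.sq_sqrt (hmax _)] at hcs
    exact hcs
  rw [h1] at h2
  nlinarith

/-- Signs, as the points of a two-element type in an arbitrary universe. -/
abbrev SignBit : Type u := ULift.{u} Bool

/-- The value `±1` of a sign. -/
def SignBit.val (b : SignBit.{u}) : ℝ := if b.down then 1 else -1

/-- The opposite sign. -/
def SignBit.flip (b : SignBit.{u}) : SignBit.{u} := ⟨!b.down⟩

theorem SignBit.val_flip (b : SignBit.{u}) : b.flip.val = -b.val := by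
  rcases b with ⟨_ | _⟩ <;> simp [SignBit.val, SignBit.flip]

theorem SignBit.flip_flip (b : SignBit.{u}) : b.flip.flip = b := by
  simp [SignBit.flip]

theorem SignBit.val_eq (b : SignBit.{u}) : b.val = 1 ∨ b.val = -1 := by
  rcases b with ⟨_ | _⟩ <;> simp [SignBit.val]

theorem SignBit.sum_val (f : ℝ → ℝ) : ∑ b : SignBit.{u}, f b.val = f 1 + f (-1) := by
  rw [← Equiv.ulift.symm.sum_comp]
  simp [SignBit.val, Equiv.ulift]

/-- The probability of the sign `y` under the law on `±1` with mean `δ b`. -/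
def signWeight (δ : ℝ) (b y : SignBit.{u}) : ℝ := (1 + δ * b.val * y.val) / 2

theorem signWeight_nonneg {δ : ℝ} (h0 : 0 ≤ δ) (h1 : δ ≤ 1) (b y : SignBit.{u}) :
    0 ≤ signWeight δ b y := by
  unfold signWeight
  rcases b.val_eq with h | h <;> rcases y.val_eq with h' | h' <;> rw [h, h'] <;> linarith

theorem sum_signWeight (δ : ℝ) (b : SignBit.{u}) : ∑ y, signWeight δ b y = 1 := by
  rw [show ∑ y, signWeight δ b y = _ from
    SignBit.sum_val.{u} (fun z => (1 + δ * b.val * z) / 2)]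
  ring

/-- The product weight of `y` with means `δ v_k`. -/
def prodWeight (δ : ℝ) (v y : Fin d → SignBit.{u}) : ℝ := ∏ k, signWeight δ (v k) (y k)

theorem sum_prod_eq_prod_sum {ι κ : Type*} [Fintype ι] [DecidableEq ι] [Fintype κ]
    (f : ι → κ → ℝ) : ∑ x : ι → κ, ∏ i, f i (x i) = ∏ i, ∑ b, f i b := by
  rw [Finset.prod_univ_sum, Fintype.piFinset_univ]

theorem sum_prodWeight (δ : ℝ) (v : Fin d → SignBit.{u}) : ∑ y, prodWeight δ v y = 1 := by
  unfold prodWeight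
  rw [sum_prod_eq_prod_sum fun k => signWeight δ (v k)]
  simp [sum_signWeight]

theorem prodWeight_nonneg {δ : ℝ} (h0 : 0 ≤ δ) (h1 : δ ≤ 1) (v y : Fin d → SignBit.{u}) :
    0 ≤ prodWeight δ v y := Finset.prod_nonneg fun _ _ => signWeight_nonneg h0 h1 _ _

theorem sum_prodWeight_mul (δ : ℝ) (v : Fin d → SignBit.{u}) (j : Fin d) (h : SignBit.{u} → ℝ) :
    ∑ y, prodWeight δ v y * h (y j) = ∑ b, signWeight δ (v j) b * h b := by
  classical
  have h1 : ∀ y : Fin d → SignBit.{u}, prodWeight δ v y * h (y j) =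
      ∏ k, (signWeight δ (v k) (y k) * if k = j then h (y k) else 1) := fun y => by
    rw [Finset.prod_mul_distrib, Finset.prod_ite_eq' Finset.univ j fun k => h (y k)]
    simp [prodWeight]
  simp only [h1]
  rw [sum_prod_eq_prod_sum fun k b => signWeight δ (v k) b * if k = j then h b else 1,
    Finset.prod_eq_single j]
  · simp
  · intro k _ hk
    simp [hk, sum_signWeight]
  · simp

variable {n : ℕ}

/-- The weight of a sample of size `n`. -/
def sampleWeight (δ : ℝ) (v : Fin d → SignBit.{u}) (x : Fin n → Fin d → SignBit.{u}) : ℝ :=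
  ∏ i, prodWeight δ v (x i)

theorem sampleWeight_nonneg {δ : ℝ} (h0 : 0 ≤ δ) (h1 : δ ≤ 1) (v : Fin d → SignBit.{u})
    (x : Fin n → Fin d → SignBit.{u}) : 0 ≤ sampleWeight δ v x :=
  Finset.prod_nonneg fun _ _ => prodWeight_nonneg h0 h1 _ _

theorem sum_sampleWeight (δ : ℝ) (v : Fin d → SignBit.{u}) :
    ∑ x : Fin n → Fin d → SignBit.{u}, sampleWeight δ v x = 1 := by
  unfold sampleWeight
  rw [sum_prod_eq_prod_sum fun _ : Fin n => prodWeight δ v]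
  simp [sum_prodWeight]

/-- Flipping the `k`-th sign. -/
def flipAt (k : Fin d) (v : Fin d → SignBit.{u}) : Fin d → SignBit.{u} :=
  Function.update v k (v k).flip

theorem flipAt_involutive (k : Fin d) : Function.Involutive (flipAt.{u} k) := fun v => by
  simp [flipAt, SignBit.flip_flip]

/-- The Hellinger affinity of two sample laws whose parameters differ in one sign. -/
theorem sum_sqrt_sampleWeight {δ : ℝ} (h0 : 0 ≤ δ) (h1 : δ ≤ 1) (v : Fin d → SignBit.{u})
    (k : Fin d) : ∑ x : Fin n → Fin d → SignBit.{u},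
      √(sampleWeight δ v x * sampleWeight δ (flipAt k v) x) = √(1 - δ ^ 2) ^ n := by
  set r : Fin d → SignBit.{u} → ℝ := fun l b =>
    √(signWeight δ (v l) b * signWeight δ (flipAt k v l) b) with hr
  have hx : ∀ x : Fin n → Fin d → SignBit.{u},
      √(sampleWeight δ v x * sampleWeight δ (flipAt k v) x) = ∏ i, ∏ l, r l (x i l) := fun x => by
    rw [Real.sqrt_eq_iff_mul_self_eq
      (mul_nonneg (sampleWeight_nonneg h0 h1 _ _) (sampleWeight_nonneg h0 h1 _ _))
      (Finset.prod_nonneg fun _ _ => Finset.prod_nonneg fun _ _ => Real.sqrt_nonneg _)]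
    simp only [sampleWeight, prodWeight, ← Finset.prod_mul_distrib]
    refine Finset.prod_congr rfl fun i _ => Finset.prod_congr rfl fun l _ => ?_
    exact (Real.mul_self_sqrt (mul_nonneg (signWeight_nonneg h0 h1 _ _)
      (signWeight_nonneg h0 h1 _ _))).symm
  -- The affinity factorises; only the flipped coordinate contributes a factor other than 1.
  have hsum : ∀ l, ∑ b, r l b = if l = k then √(1 - δ ^ 2) else 1 := fun l => by
    split_ifs with hl
    · subst hl
      have hb : ∀ b, r l b = √(1 - δ ^ 2) / 2 := fun b => by
        have : signWeight δ (v l) b * signWeight δ (flipAt l v l) b = (1 - δ ^ 2) / 2 ^ 2 := by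
          simp only [signWeight, flipAt, Function.update_self, SignBit.val_flip]
          rcases (v l).val_eq with h | h <;> rcases b.val_eq with h' | h' <;> rw [h, h'] <;> ring
        simp only [hr]
        rw [this, Real.sqrt_div' _ (by positivity), Real.sqrt_sq (by norm_num)]
      simp only [hb]
      simp
      ring
    · have hb : ∀ b, r l b = signWeight δ (v l) b := fun b => by
        simp only [hr, flipAt, Function.update_of_ne hl]
        exact Real.sqrt_mul_self (signWeight_nonneg h0 h1 _ _)
      simp only [hb, sum_signWeight]
  simp only [hx]
  rw [sum_prod_eq_prod_sum fun (_ : Fin n) (y : Fin d → SignBit.{u}) => ∏ l, r l (y l)]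
  rw [sum_prod_eq_prod_sum r]
  simp [hsum]

/-- Assouad's lemma for one coordinate: the average probability of a wrong sign. -/
theorem card_div_four_le_sum_error {δ : ℝ} (h0 : 0 ≤ δ) (h1 : δ ≤ 1) (hnδ : n * δ ^ 2 ≤ 1 / 4)
    (e : (Fin n → Fin d → SignBit.{u}) → ℝ) (k : Fin d) :
    (Fintype.card (Fin d → SignBit.{u}) : ℝ) / 4 ≤
      ∑ v : Fin d → SignBit.{u}, ∑ x, sampleWeight δ v x * if (v k).val * e x ≤ 0 then 1 else 0 := by
  set A : (Fin d → SignBit.{u}) → ℝ := fun v =>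
    ∑ x, sampleWeight δ v x * if (v k).val * e x ≤ 0 then 1 else 0 with hA
  -- The sign of `e x` cannot be right for both `v` and its flip (a zero counts as wrong for both),
  -- so the errors add up to at least `∑ min`. Bernoulli's inequality gives `(1 - δ²)^n ≥ 1 - n δ² ≥
  -- 3 / 4`.
  have hpair : ∀ v, 1 / 2 ≤ A v + A (flipAt k v) := fun v => by
    have hδ1 : 0 ≤ 1 - δ ^ 2 := by nlinarith
    have hbc : 3 / 4 ≤ (∑ x : Fin n → Fin d → SignBit.{u},
        √(sampleWeight δ v x * sampleWeight δ (flipAt k v) x)) ^ 2 := by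
      rw [sum_sqrt_sampleWeight h0 h1, ← pow_mul, mul_comm, pow_mul, Real.sq_sqrt hδ1]
      have := one_add_mul_le_pow (a := -δ ^ 2) (by nlinarith) n
      rw [← sub_eq_add_neg] at this
      linarith
    refine (half_le_sum_min (fun x => sampleWeight_nonneg h0 h1 v x)
      (fun x => sampleWeight_nonneg h0 h1 (flipAt k v) x) (sum_sampleWeight δ v)
      (sum_sampleWeight δ _) hbc).trans ?_
    simp only [hA]
    rw [← Finset.sum_add_distrib]
    refine Finset.sum_le_sum fun x _ => ?_
    have hw := sampleWeight_nonneg h0 h1 v x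
    have hw' := sampleWeight_nonneg h0 h1 (flipAt k v) x
    have hflip : ((flipAt k v) k).val = -(v k).val := by simp [flipAt, SignBit.val_flip]
    rw [hflip]
    by_cases hc : (v k).val * e x ≤ 0
    · refine (min_le_left _ _).trans ?_
      rw [if_pos hc, mul_one]
      split_ifs <;> linarith
    · refine (min_le_right _ _).trans ?_
      rw [if_neg hc, if_pos (by linarith)]
      linarith
  have hinv : ∑ v, A (flipAt k v) = ∑ v, A v :=
    Equiv.sum_comp (Function.Involutive.toPerm _ (flipAt_involutive k)) A
  have hsum := Finset.card_nsmul_le_sum Finset.univ (fun v => A v + A (flipAt k v)) (1 / 2)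
    fun v _ => hpair v
  rw [Finset.sum_add_distrib, hinv, nsmul_eq_mul, Finset.card_univ] at hsum
  linarith

end Assouad

/-! ### Lower bound for the stochastic risk -/

section LowerBound

theorem exists_probabilityMeasure_of_weights {X : Type u} [Fintype X] [MeasurableSpace X]
    [MeasurableSingletonClass X] {w : X → ℝ} (h0 : ∀ x, 0 ≤ w x) (h1 : ∑ x, w x = 1) :
    ∃ P : ProbabilityMeasure X, ∀ x, (P : Measure X).real {x} = w x := by
  have hsum : ∑ x, ENNReal.ofReal (w x) = 1 := by
    rw [← ENNReal.ofReal_sum_of_nonneg fun x _ => h0 x, h1, ENNReal.ofReal_one]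
  refine ⟨⟨(PMF.ofFintype _ hsum).toMeasure, inferInstance⟩, fun x => ?_⟩
  rw [Measure.real, ProbabilityMeasure.coe_mk, PMF.toMeasure_apply_singleton _ _
    (measurableSet_singleton x), PMF.ofFintype_apply, ENNReal.toReal_ofReal (h0 x)]

/-- The separable loss `∑ g_k |θ_k - x_k t_k|`. -/
def absLoss (g t : Vec d) (θ : Vec d) (x : Fin d → SignBit.{u}) : ℝ :=
  ∑ k, g k * |θ k - (x k).val * t k|

theorem absLoss_mem [MeasurableSpace (Fin d → SignBit.{u})]
    [DiscreteMeasurableSpace (Fin d → SignBit.{u})] {γ : Seminorm ℝ (Vec d)}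
    (hγo : OrthosymmetricNorm γ) {g : Vec d} (t : Vec d) (hg0 : ∀ k, 0 ≤ g k) (hg : γ g ≤ 1) :
    absLoss.{u} g t ∈ lossFamily (Fin d → SignBit.{u}) γ 1 := by
  classical
  refine ⟨fun x => ⟨⟨convex_univ, fun a _ b _ p q hp hq hpq => ?_⟩, fun θ h hh => ?_⟩,
    fun θ => Measurable.of_discrete⟩
  · simp only [absLoss, smul_eq_mul, Finset.mul_sum, ← Finset.sum_add_distrib]
    refine Finset.sum_le_sum fun k _ => ?_
    set c := (x k).val * t k
    have hdec : (p • a + q • b) k - c = p * (a k - c) + q * (b k - c) := by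
      simp only [Pi.add_apply, Pi.smul_apply, smul_eq_mul]
      linear_combination c * hpq
    rw [hdec]
    have h1 := abs_add_le (p * (a k - c)) (q * (b k - c))
    rw [abs_mul, abs_mul, abs_of_nonneg hp, abs_of_nonneg hq] at h1
    have := mul_le_mul_of_nonneg_left h1 (hg0 k)
    linarith
  · refine (hγo.mono fun k => ?_).trans hg
    -- A unit move along `±e_k` changes the loss by at most `g_k`, so `|h_k| ≤ g_k` and monotonicity
    -- of `γ` applies.
    have hstep : ∀ s : ℝ, |s| = 1 → s * h k ≤ g k := fun s hs => by
      have h1 := hh (θ + Pi.single k s)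
      rw [add_sub_cancel_left, dotProduct_single] at h1
      have h2 : absLoss g t (θ + Pi.single k s) x - absLoss g t θ x ≤ g k := by
        rw [absLoss, absLoss, ← Finset.sum_sub_distrib, Finset.sum_eq_single k]
        · rw [← mul_sub]
          refine mul_le_of_le_one_right (hg0 k) ?_
          have := abs_sub_abs_le_abs_sub ((θ + Pi.single k s : Vec d) k - (x k).val * t k)
            (θ k - (x k).val * t k)
          refine this.trans (le_of_eq ?_)
          rw [← hs]
          congr 1
          simp
        · intro l _ hl
          simp [hl]
        · simp
      simp only at h1
      linarith
    rw [abs_of_nonneg (hg0 k), abs_le]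
    have := hstep 1 (by simp)
    have := hstep (-1) (by simp)
    constructor <;> linarith

/-- The excess mean loss in one coordinate. -/
theorem mul_ite_le_excess {δ t s z : ℝ} (h0 : 0 ≤ δ) (h1 : δ ≤ 1)
    (hs : s = 1 ∨ s = -1) :
    δ * t * (if s * z ≤ 0 then 1 else 0) ≤
      ((1 + δ * s) / 2 * |z - t| + (1 - δ * s) / 2 * |z + t|) - (1 - δ) * t := by
  -- The substitution `y = s z` reduces to `s = 1`. For `t ≥ 0`, `(1 - δ) t` is the mean loss at `y
  -- = t`; for `y ≤ 0` the mean loss is at least `t - δ y ≥ t`.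
  have hcore : ∀ y : ℝ, δ * t * (if y ≤ 0 then 1 else 0) ≤
      ((1 + δ) / 2 * |y - t| + (1 - δ) / 2 * |y + t|) - (1 - δ) * t := fun y => by
    have e1 : y + t ≤ |y + t| := le_abs_self _
    have e2 : 0 ≤ |y - t| := abs_nonneg _
    have e3 : -(y - t) ≤ |y - t| := neg_le_abs _
    have m1 := mul_le_mul_of_nonneg_left e1 (show 0 ≤ (1 - δ) / 2 by linarith)
    split_ifs with hy
    · have m2 := mul_le_mul_of_nonneg_left e3 (show 0 ≤ (1 + δ) / 2 by linarith)
      have m3 := mul_nonneg h0 (neg_nonneg.2 hy)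
      linarith
    · have m2 := mul_le_mul_of_nonneg_left e3 (show 0 ≤ (1 - δ) / 2 by linarith)
      have m3 := mul_nonneg h0 e2
      linarith
  rcases hs with rfl | rfl
  · simpa using hcore z
  · have := hcore (-z)
    rw [abs_sub_comm (-z), ← abs_neg (-z + t)] at this
    have e1 : t - -z = z + t := by ring
    have e2 : -(-z + t) = z - t := by ring
    rw [e1, e2] at this
    have e3 : (-1 : ℝ) * z = -z := by ring
    rw [e3]
    linarith

variable {n : ℕ} {Θ : Set (Vec d)} {γ : Seminorm ℝ (Vec d)}

theorem div_mul_sum_le_minimaxStochasticRisk (hn : 1 ≤ n) (hΘo : Orthosymmetric Θ)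
    (hγo : OrthosymmetricNorm γ) {g t : Vec d} (hg0 : ∀ k, 0 ≤ g k) (hg : γ g ≤ 1)
    (ht0 : ∀ k, 0 ≤ t k) (ht : t ∈ Θ) :
    ((1 / (8 * √(n : ℝ)) * ∑ k, g k * t k : ℝ) : EReal) ≤ minimaxStochasticRisk.{u} n Θ γ := by
  classical
  have hn0 : (1 : ℝ) ≤ √n := Real.one_le_sqrt.2 (by exact_mod_cast hn)
  -- The largest bias with `n δ² ≤ 1 / 4`; the final constant is `δ / 4 = 1 / (8√n)`.
  set δ : ℝ := 1 / (2 * √n) with hδ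
  have h0 : 0 ≤ δ := by positivity
  have h1 : δ ≤ 1 := by
    rw [hδ, div_le_one (by positivity)]; linarith
  have hnδ : n * δ ^ 2 ≤ 1 / 4 := by
    have hsq : √(n : ℝ) ^ 2 = n := Real.sq_sqrt (Nat.cast_nonneg n)
    have hnp : (0 : ℝ) < n := by exact_mod_cast hn
    rw [hδ, div_pow, mul_pow, hsq]
    refine le_of_eq ?_
    field_simp
    norm_num
  let mX : MeasurableSpace (Fin d → SignBit.{u}) := ⊤
  have : DiscreteMeasurableSpace (Fin d → SignBit.{u}) := ⟨fun _ => trivial⟩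
  have hP := fun v : Fin d → SignBit.{u} => exists_probabilityMeasure_of_weights
    (prodWeight_nonneg h0 h1 v) (sum_prodWeight δ v)
  choose P hP using hP
  refine le_iSup_of_le (Fin d → SignBit.{u}) (le_iSup_of_le mX (le_iSup_of_le (Set.range P) ?_))
  refine le_iInf fun est => ?_
  have hint : ∀ v θ, Integrable (absLoss g t θ) (P v : Measure (Fin d → SignBit.{u})) :=
    fun v θ => Integrable.of_finite
  have hloss : ∀ v θ, expLoss (absLoss g t) (P v) θ = ∑ k, g k *
      ((1 + δ * (v k).val) / 2 * |θ k - t k| + (1 - δ * (v k).val) / 2 * |θ k + t k|) := by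
    intro v θ
    rw [expLoss, integral_fintype Integrable.of_finite]
    simp only [hP, smul_eq_mul, absLoss, Finset.mul_sum]
    rw [Finset.sum_comm]
    refine Finset.sum_congr rfl fun k _ => ?_
    have e1 := sum_prodWeight_mul δ v k fun b => g k * |θ k - b.val * t k|
    have e2 := SignBit.sum_val.{u} fun z => (1 + δ * (v k).val * z) / 2 * (g k * |θ k - z * t k|)
    rw [e1]
    refine e2.trans ?_
    rw [one_mul, neg_one_mul, sub_neg_eq_add]
    ring
  set e : (Fin n → Fin d → SignBit.{u}) → Vec d := fun x =>
    est.1 fun i => observe (absLoss g t) (x i) with he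
  set Y : (Fin d → SignBit.{u}) → (Fin n → Fin d → SignBit.{u}) → ℝ := fun v x =>
    expLoss (absLoss g t) (P v) (e x) - sInf (expLoss (absLoss g t) (P v) '' Θ) with hY
  have hYle : ∀ v x, ∑ k, g k * (δ * t k * (if (v k).val * e x k ≤ 0 then 1 else 0)) ≤ Y v x := by
    intro v x
    -- Orthosymmetry puts the comparator `v ⊙ t` into `Θ`.
    have hmem : (fun k => (v k).val * t k) ∈ Θ := hΘo t ht _ fun k => (v k).val_eq
    have hinf : sInf (expLoss (absLoss g t) (P v) '' Θ) ≤ ∑ k, g k * ((1 - δ) * t k) := by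
      have hbdd : BddBelow (expLoss (absLoss g t) (P v) '' Θ) := by
        refine ⟨0, ?_⟩
        rintro _ ⟨τ, -, rfl⟩
        exact integral_nonneg fun x => Finset.sum_nonneg fun k _ =>
          mul_nonneg (hg0 k) (abs_nonneg _)
      refine (csInf_le hbdd (Set.mem_image_of_mem _ hmem)).trans (le_of_eq ?_)
      rw [hloss]
      refine Finset.sum_congr rfl fun k _ => ?_
      have e1 : |2 * t k| = 2 * t k := abs_of_nonneg (by linarith [ht0 k])
      rcases (v k).val_eq with h | h <;> rw [h]
      · rw [show 1 * t k - t k = 0 by ring, show 1 * t k + t k = 2 * t k by ring, abs_zero, e1]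
        ring
      · rw [show -1 * t k - t k = -(2 * t k) by ring, show -1 * t k + t k = 0 by ring, abs_zero,
          abs_neg, e1]
        ring
    have hle : ∑ k, g k * (δ * t k * (if (v k).val * e x k ≤ 0 then 1 else 0)) +
        ∑ k, g k * ((1 - δ) * t k) ≤ expLoss (absLoss g t) (P v) (e x) := by
      rw [hloss, ← Finset.sum_add_distrib]
      refine Finset.sum_le_sum fun k _ => ?_
      rw [← mul_add]
      refine mul_le_mul_of_nonneg_left ?_ (hg0 k)
      have := mul_ite_le_excess (t := t k) (z := e x k) h0 h1 (v k).val_eq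
      linarith
    simp only [hY]
    linarith
  have hexp : ∀ v, expectation (Measure.pi fun _ : Fin n =>
      (P v : Measure (Fin d → SignBit.{u}))) (Y v) =
      ((∑ x, sampleWeight δ v x * Y v x : ℝ) : EReal) := fun v => by
    rw [expectation_eq_integral Integrable.of_finite, integral_fintype Integrable.of_finite]
    congr 1
    refine Finset.sum_congr rfl fun x _ => ?_
    rw [Measure.real, Measure.pi_singleton, ENNReal.toReal_prod, smul_eq_mul, sampleWeight]
    simp only [← hP]
    rfl
  have htotal : (Fintype.card (Fin d → SignBit.{u}) : ℝ) * (1 / (8 * √n) * ∑ k, g k * t k) ≤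
      ∑ v, ∑ x, sampleWeight δ v x * Y v x := by
    calc (Fintype.card (Fin d → SignBit.{u}) : ℝ) * (1 / (8 * √n) * ∑ k, g k * t k)
        = ∑ k, g k * (δ * t k) * ((Fintype.card (Fin d → SignBit.{u}) : ℝ) / 4) := by
          rw [← Finset.sum_mul]
          have : ∑ k, g k * (δ * t k) = δ * ∑ k, g k * t k := by
            rw [Finset.mul_sum]; exact Finset.sum_congr rfl fun k _ => by ring
          rw [this, hδ]
          field_simp
          ring
      _ ≤ ∑ k, g k * (δ * t k) * ∑ v : Fin d → SignBit.{u}, ∑ x, sampleWeight δ v x *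
            if (v k).val * e x k ≤ 0 then 1 else 0 :=
          Finset.sum_le_sum fun k _ => mul_le_mul_of_nonneg_left
            (card_div_four_le_sum_error h0 h1 hnδ (fun x => e x k) k)
            (mul_nonneg (hg0 k) (mul_nonneg h0 (ht0 k)))
      _ = ∑ v, ∑ x, sampleWeight δ v x *
            ∑ k, g k * (δ * t k * (if (v k).val * e x k ≤ 0 then 1 else 0)) := by
          simp only [Finset.mul_sum]
          rw [Finset.sum_comm]
          refine Finset.sum_congr rfl fun v _ => ?_
          rw [Finset.sum_comm]
          refine Finset.sum_congr rfl fun x _ => Finset.sum_congr rfl fun k _ => by ring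
      _ ≤ ∑ v, ∑ x, sampleWeight δ v x * Y v x :=
          Finset.sum_le_sum fun v _ => Finset.sum_le_sum fun x _ =>
            mul_le_mul_of_nonneg_left (hYle v x) (sampleWeight_nonneg h0 h1 v x)
  -- The worst `v` is at least as bad as the average over the cube.
  obtain ⟨v, -, hv⟩ : ∃ v ∈ Finset.univ, 1 / (8 * √n) * ∑ k, g k * t k ≤
      ∑ x, sampleWeight δ v x * Y v x := by
    refine Finset.exists_le_of_sum_le Finset.univ_nonempty (le_trans (le_of_eq ?_) htotal)
    rw [Finset.sum_const, nsmul_eq_mul, Finset.card_univ]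
  refine le_trans (EReal.coe_le_coe_iff.2 hv) ((hexp v).symm.le.trans ?_)
  exact le_iSup₂_of_le (absLoss g t) (absLoss_mem hγo t hg0 hg)
    (le_iSup₂_of_le (P v) ⟨v, rfl⟩ (le_iSup_of_le (hint v) le_rfl))

theorem mul_sSup_le_minimaxStochasticRisk (hn : 1 ≤ n) (hΘne : Θ.Nonempty)
    (hΘo : Orthosymmetric Θ) (hγo : OrthosymmetricNorm γ) :
    ((1 / (8 * √(Real.log 3)) * (1 / √(n : ℝ)) * sSup (dualNorm γ '' Θ) : ℝ) : EReal) ≤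
      minimaxStochasticRisk.{u} n Θ γ := by
  have hn0 : (0 : ℝ) < √n := Real.sqrt_pos.2 (by exact_mod_cast hn)
  -- Since `e < 3`, the stated constant is at most the `1 / 8` obtained from Assouad's method.
  have hlog : 1 ≤ √(Real.log 3) := by
    refine Real.one_le_sqrt.2 ((Real.le_log_iff_exp_le (by norm_num)).2 ?_)
    linarith [Real.exp_one_lt_d9]
  have hpair : ∀ g, γ g ≤ 1 → ∀ θ ∈ Θ,
      ((1 / (8 * √(n : ℝ)) * ∑ k, |g k| * |θ k| : ℝ) : EReal) ≤
        minimaxStochasticRisk.{u} n Θ γ := fun g hg θ hθ => by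
    refine div_mul_sum_le_minimaxStochasticRisk hn hΘo hγo (g := fun k => |g k|)
      (t := fun k => |θ k|) (fun k => abs_nonneg _)
      ((hγo.mono fun k => by rw [abs_abs]).trans hg) (fun k => abs_nonneg _) ?_
    have := hΘo θ hθ (fun k => if θ k < 0 then -1 else 1) fun k => by
      by_cases h : θ k < 0 <;> simp [h]
    convert this using 1
    ext k
    split_ifs with h
    · rw [abs_of_neg h]; ring
    · rw [abs_of_nonneg (not_lt.1 h)]; ring
  -- A real `y` strictly between the two sides lets the suprema over `g` and `θ` be taken in `ℝ`,
  -- although the risk is an extended real.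
  by_contra hcon
  obtain ⟨y, hy1, hy2⟩ := EReal.lt_iff_exists_real_btwn.1 (not_le.1 hcon)
  rw [EReal.coe_lt_coe_iff] at hy2
  have hy : ∀ g, γ g ≤ 1 → ∀ θ ∈ Θ, 1 / (8 * √(n : ℝ)) * ∑ k, |g k| * |θ k| < y :=
    fun g hg θ hθ => by exact_mod_cast (hpair g hg θ hθ).trans_lt hy1
  have hy0 : 0 < y := by
    obtain ⟨θ, hθ⟩ := hΘne
    simpa using hy 0 (by simp) θ hθ
  have hsup : sSup (dualNorm γ '' Θ) ≤ 8 * √n * y := by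
    refine csSup_le (hΘne.image _) ?_
    rintro _ ⟨θ, hθ, rfl⟩
    refine csSup_le ⟨_, 0, by simp, rfl⟩ ?_
    rintro _ ⟨g, hg, rfl⟩
    have h1 := (hy g hg θ hθ).le
    rw [one_div_mul_eq_div, div_le_iff₀ (by positivity)] at h1
    have h2 : g ⬝ᵥ θ ≤ ∑ k, |g k| * |θ k| := Finset.sum_le_sum fun k _ => by
      rw [← abs_mul]; exact le_abs_self _
    simp only
    linarith
  have : 1 / (8 * √(Real.log 3)) * (1 / √(n : ℝ)) * sSup (dualNorm γ '' Θ) ≤ y := by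
    calc 1 / (8 * √(Real.log 3)) * (1 / √(n : ℝ)) * sSup (dualNorm γ '' Θ)
        ≤ 1 / (8 * √(Real.log 3)) * (1 / √(n : ℝ)) * (8 * √n * y) :=
          mul_le_mul_of_nonneg_left hsup (by positivity)
      _ = y / √(Real.log 3) := by field_simp
      _ ≤ y := div_le_self hy0.le hlog
  linarith

end LowerBound

end MinimaxGeometry

end

theorem mainTheorem1 {d n : ℕ} (hn : 1 ≤ n)
    (Θ : Set (MinimaxGeometry.Vec d)) (γ : Seminorm ℝ (MinimaxGeometry.Vec d))
    (hΘne : Θ.Nonempty) (hΘc : IsCompact Θ) (hΘo : MinimaxGeometry.Orthosymmetric Θ)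
    (hΘq : MinimaxGeometry.QuadConvex Θ)
    (hγ : MinimaxGeometry.IsNorm γ) (hγo : MinimaxGeometry.OrthosymmetricNorm γ)
    (hγq : MinimaxGeometry.QuadConvexNorm γ) :
    ((1 / (8 * √(Real.log 3)) * (1 / √(n : ℝ)) * sSup (MinimaxGeometry.dualNorm γ '' Θ) : ℝ)
        : EReal) ≤ MinimaxGeometry.minimaxStochasticRisk.{u} n Θ γ ∧
    MinimaxGeometry.minimaxStochasticRisk.{u} n Θ γ ≤ MinimaxGeometry.minimaxRegret.{u} n Θ γ ∧
    MinimaxGeometry.minimaxRegret.{u} n Θ γ ≤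
      ((1 / √(n : ℝ) * sSup (MinimaxGeometry.dualNorm γ '' Θ) : ℝ) : EReal) ∧
    ∃ lam : MinimaxGeometry.Vec d, (∀ j, 0 ≤ lam j) ∧
      (∀ j, (∃ θ ∈ Θ, θ j ≠ 0) → 0 < lam j) ∧
      ∀ f : Fin n → MinimaxGeometry.Vec d → ℝ,
        (∀ i, f i ∈ MinimaxGeometry.ConvexLosses γ 1) →
        ∀ θ : ℕ → MinimaxGeometry.Vec d, MinimaxGeometry.IsDiagScaledRun lam f θ →
        ∀ τ ∈ Θ, (1 / (n : ℝ)) * ∑ i : Fin n, (f i (θ i) - f i τ) ≤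
          1 / √(n : ℝ) * sSup (MinimaxGeometry.dualNorm γ '' Θ) := by
  obtain ⟨μ, hμ0, hμpos, hμΘ, hμγ⟩ :=
    MinimaxGeometry.exists_diagonal_scaling hΘne hΘc hΘq hγ hγo hγq
  have hs : 0 < √(n : ℝ) := Real.sqrt_pos.2 (by exact_mod_cast hn)
  refine ⟨MinimaxGeometry.mul_sSup_le_minimaxStochasticRisk hn hΘne hΘo hγo,
    MinimaxGeometry.minimaxStochasticRisk_le_minimaxRegret hn hΘne hΘc hγ hγo,
    MinimaxGeometry.minimaxRegret_le hn hΘne hΘc hγ hγo hμ0 hμpos hμΘ hμγ,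
    -- `μ` balances the geometry of `Θ` against that of `γ`; the factor `√n` tunes the step size to
    -- the horizon.
    fun j => √n * μ j, fun j => mul_nonneg hs.le (hμ0 j),
    fun j hj => mul_pos hs (hμpos j hj), fun f hf θ hθ τ hτ => ?_⟩
  exact MinimaxGeometry.regret_le_of_isDiagScaledRun hn hμ0 (fun j hj => hμpos j ⟨τ, hτ, hj⟩)
    (hμΘ τ hτ) hμγ hf hθ
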